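/- Let $X$ be a set totally ordered by $<$, and assume that $X$, with its order topology, is compact and separable. Then $X$ has the Complex Stone–Weierstrass Property (CSWP) if and only if $X$ does not contain a copy of the Cantor set. Here a compact Hausdorff space $X$ has the CSWP if every complex subalgebra of $C(X,\mathbb{C})$ which separates the points of $X$ and contains the constant functions is dense in $C(X,\mathbb{C})$ with respect to the supremum norm, and $X$ contains a copy of the Cantor set if some subspace of $X$ is homeomorphic to the Cantor set. -/

import Mathlib

/-- The Complex Stone-Weierstrass Property of a (compact Hausdorff) space `X`: every complex
subalgebra of `C(X, ℂ)` which separates the points of `X` is dense in `C(X, ℂ)`.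
A Mathlib `Subalgebra ℂ` contains the constant functions by definition, and it need not be
closed under complex conjugation. For compact `X` the topology of `C(X, ℂ)` is that of the
supremum norm. -/
def HasCSWP (X : Type*) [TopologicalSpace X] : Prop :=
  ∀ A : Subalgebra ℂ C(X, ℂ), A.SeparatesPoints → Dense (A : Set C(X, ℂ))

/-- `X` contains a copy of the Cantor set: some subspace of `X` is homeomorphic to the
ternary Cantor set, that is, the Cantor set embeds topologically in `X`. -/
def ContainsCantorSet (X : Type*) [TopologicalSpace X] : Prop :=
  ∃ f : cantorSet → X, Topology.IsEmbedding f

/-!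
Both implications are proved by elementary function theory on closed subsets of `X`.

*No Cantor set implies the CSWP.* Call a closed set `S` split by an algebra `A` if the real part of
some member of `A` has no zero on `S` but takes both signs there. Such a member `f` yields
approximate indicator functions in `A` of the piece of `S` where `0 < Re f`: after an affine
normalisation `φ` of `f` this piece is `{‖φ‖ < 1}`, the unit circle lies in the resolvent set of
`φ` relative to the closure of `A` in `C(S, ℂ)`, and `1 / (1 + φ ^ n)` tends to the indicator
function. A minimal closed set on which a given function keeps its distance from `A` cannot be
split, so `A` is dense as soon as every closed set with at least two points is split
(`Subalgebra.dense_of_exists_split`).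

A countable `S` is split because the real part of a function on it omits some level between any two
of its values. If `S` is uncountable and contains no Cantor set, it is not metrizable, and by
separability it contains both ends of uncountably many jumps `x ⋖ x⁺` of `X`. For each of them `A`
contains a function `f` with `f x = 0` and `f x⁺ = 1`. Its real part `h` is described up to a small
error by finitely many rational data: a finite cover of `X` by intervals with end points in a
countable dense set, on each of which `h` takes nearly one value on the left and nearly another on
the right, the two being the values of `h` at the ends of a jump. Two points `x < y` share these
data, so the difference of their functions takes values only near `0` and near plus or minus the
jumps of the first one; it is near `0` at `x` and near `1` at `x⁺`. The jumps accumulate only at `0`,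
so some level in between is avoided (`exists_sub_avoids_level`).

*The CSWP implies no Cantor set.* The CSWP passes to closed subspaces by Tietze's theorem, so it
suffices to find a subspace of the Cantor set without it. Following Rudin, take a compact `K ⊆ ℂ` of
positive area consisting of points with irrational coordinates, and the algebra of bounded continuous
functions on `ℂ` which are holomorphic off `K`. The Cauchy transform of `K` is a nonconstant member,
and division of differences by `z - b` produces enough others to separate points. By the maximum
principle, evaluation at a point off `K` is a bounded character of the restricted algebra, and it is
not an evaluation at a point of `K`; hence the restrictions are not dense (`not_hasCSWP_of_volume_pos`).
-/

open Set Filter Topology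

/-! ### Approximate indicator functions and a density criterion -/

lemma IsCompact.exists_pos_forall_le_of_pos {X : Type*} [TopologicalSpace X] {K : Set X}
    (hK : IsCompact K) {φ : X → ℝ} (hφ : ContinuousOn φ K) (hpos : ∀ x ∈ K, 0 < φ x) :
    ∃ η > 0, ∀ x ∈ K, η ≤ φ x := by
  rcases K.eq_empty_or_nonempty with rfl | hne
  · exact ⟨1, one_pos, by simp⟩
  · obtain ⟨x, hx, hmin⟩ := hK.exists_isMinOn hne hφ
    exact ⟨φ x, hpos x hx, fun y hy => hmin hy⟩

/-- If the values of a member of a closed subalgebra avoid the unit circle, and its spectrum in the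
subalgebra misses one point of this circle, then that spectrum misses the whole circle, because the
circle lies in a single component of the resolvent set in `C(S, ℂ)`. -/
lemma notMem_spectrum_of_norm_eq {S : Type*} [TopologicalSpace S] [CompactSpace S]
    (B : Subalgebra ℂ C(S, ℂ)) [hB : IsClosed (B : Set C(S, ℂ))] (φ : B)
    (hφ : ∀ x, ‖(φ : C(S, ℂ)) x‖ ≠ 1) (h1 : (1 : ℂ) ∉ spectrum ℂ φ) {z : ℂ} (hz : ‖z‖ = 1) :
    z ∉ spectrum ℂ φ := by
  have hsub : Metric.sphere (0 : ℂ) 1 ⊆ (spectrum ℂ (φ : C(S, ℂ)))ᶜ := by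
    intro w hw hw'
    rw [ContinuousMap.spectrum_eq_range] at hw'
    obtain ⟨x, rfl⟩ := hw'
    exact hφ x (by simpa using hw)
  have hconn : IsPreconnected (Metric.sphere (0 : ℂ) 1) :=
    isPreconnected_sphere (by rw [Complex.rank_real_complex]; norm_num) 0 1
  intro hzs
  apply h1
  rw [Subalgebra.spectrum_sUnion_connectedComponentIn B φ]
  refine Or.inr (mem_biUnion (x := z) ⟨hzs, hsub (by simpa using hz)⟩ ?_)
  exact hconn.subset_connectedComponentIn (by simpa using hz) hsub (by simp)

lemma Subalgebra.norm_le_norm_coe_of_mem_spectrum {E : Type*} [NormedRing E] [NormedAlgebra ℂ E]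
    [NormOneClass E] (B : Subalgebra ℂ E) [CompleteSpace B] {f : B} {z : ℂ}
    (hz : z ∈ spectrum ℂ f) : ‖z‖ ≤ ‖(f : E)‖ := by
  have h := spectrum.norm_le_norm_mul_of_mem (A := B) hz
  have h1 : ‖(1 : B)‖ = 1 := norm_one (α := E)
  rw [h1, mul_one] at h
  exact h

lemma one_notMem_spectrum_smul_sub_one {B : Type*} [Ring B] [Algebra ℂ B] {a : B} {c : ℂ}
    (hc : c ≠ 0) (h : 2 * c ∉ spectrum ℂ a) : (1 : ℂ) ∉ spectrum ℂ (c⁻¹ • a - 1) := by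
  rw [spectrum.notMem_iff] at h ⊢
  have : algebraMap ℂ B 1 - (c⁻¹ • a - 1) = c⁻¹ • (algebraMap ℂ B (2 * c) - a) := by
    rw [smul_sub, Algebra.algebraMap_eq_smul_one (2 * c : ℂ), smul_smul, map_one,
      show c⁻¹ * (2 * c) = 2 by field_simp, two_smul]
    abel
  rw [this]
  exact h.smul (Units.mk0 _ (inv_ne_zero hc))

lemma isUnit_one_add_pow {S : Type*} [TopologicalSpace S] [CompactSpace S]
    (B : Subalgebra ℂ C(S, ℂ)) [hB : IsClosed (B : Set C(S, ℂ))] (φ : B)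
    (hφ : ∀ x, ‖(φ : C(S, ℂ)) x‖ ≠ 1) (h1 : (1 : ℂ) ∉ spectrum ℂ φ) {n : ℕ} (hn : 0 < n) :
    IsUnit (1 + φ ^ n) := by
  rcases isEmpty_or_nonempty S with hS | hS
  · exact ⟨1, Subtype.ext (ContinuousMap.ext fun x => hS.elim x)⟩
  have : CompleteSpace B := hB.completeSpace_coe
  have h2 : (-1 : ℂ) ∉ spectrum ℂ (φ ^ n) := by
    rw [spectrum.map_pow_of_pos φ hn]
    rintro ⟨z, hz, hzn⟩
    refine notMem_spectrum_of_norm_eq B φ hφ h1 ?_ hz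
    have : ‖z‖ ^ n = 1 := by
      rw [← norm_pow]; simp only at hzn; rw [hzn]; simp
    exact (pow_eq_one_iff_of_nonneg (norm_nonneg _) hn.ne').1 this
  rw [spectrum.notMem_iff] at h2
  have h3 := h2.neg
  rwa [map_neg, map_one, neg_sub, sub_neg_eq_add, add_comm] at h3

lemma norm_sub_one_lt_of_one_add_mul_eq_one {t w : ℂ} {e : ℝ} (he : e ≤ 1 / 4) (ht : ‖t‖ < e)
    (hw : (1 + t) * w = 1) : ‖w - 1‖ < 4 * e := by
  have h4 : 1 - ‖t‖ ≤ ‖1 + t‖ := by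
    have := norm_sub_norm_le (1 : ℂ) (-t)
    simpa using this
  have h5 : ‖1 + t‖ * ‖w‖ = 1 := by rw [← norm_mul, hw, norm_one]
  have h6 : ‖w‖ ≤ 2 := by nlinarith [norm_nonneg w]
  have h7 : w - 1 = -(t * w) := by linear_combination hw
  rw [h7, norm_neg, norm_mul]
  nlinarith [norm_nonneg t, norm_nonneg w]

lemma norm_lt_of_one_add_mul_eq_one {t w : ℂ} {e : ℝ} (he : 0 < e) (he' : e ≤ 1 / 4)
    (ht : 1 / e < ‖t‖) (hw : (1 + t) * w = 1) : ‖w‖ < 4 * e := by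
  have h4 : ‖t‖ - 1 ≤ ‖1 + t‖ := by
    have := norm_sub_norm_le t (-1 : ℂ)
    rw [add_comm]
    simpa using this
  have h5 : ‖1 + t‖ * ‖w‖ = 1 := by rw [← norm_mul, hw, norm_one]
  have h6 : 1 < ‖t‖ * e := by rwa [div_lt_iff₀ he] at ht
  have h7 : (‖t‖ - 1) * ‖w‖ ≤ 1 := (mul_le_mul_of_nonneg_right h4 (norm_nonneg w)).trans_eq h5
  have h8 : 3 / 4 ≤ (‖t‖ - 1) * e := by nlinarith
  by_contra! hcon
  have h9 : (‖t‖ - 1) * (4 * e) ≤ (‖t‖ - 1) * ‖w‖ := by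
    apply mul_le_mul_of_nonneg_left hcon
    nlinarith
  linarith

/-- The functions `1 / (1 + φ ^ n)` belong to the algebra and tend to the indicator function of
`{‖φ‖ < 1}`. -/
lemma exists_mem_near_indicator_ball {S : Type*} [TopologicalSpace S] [CompactSpace S]
    (B : Subalgebra ℂ C(S, ℂ)) [hB : IsClosed (B : Set C(S, ℂ))] (φ : B)
    (hφ : ∀ x, ‖(φ : C(S, ℂ)) x‖ ≠ 1) (h1 : (1 : ℂ) ∉ spectrum ℂ φ) {ε : ℝ} (hε : 0 < ε) :
    ∃ k ∈ B, (∀ x, ‖(φ : C(S, ℂ)) x‖ < 1 → ‖k x - 1‖ < ε) ∧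
      ∀ x, 1 < ‖(φ : C(S, ℂ)) x‖ → ‖k x‖ < ε := by
  obtain ⟨δ, hδ, hδφ⟩ := isCompact_univ.exists_pos_forall_le_of_pos
    (φ := fun x : S => |‖(φ : C(S, ℂ)) x‖ - 1|) (by fun_prop)
    (fun x _ => abs_pos.2 (sub_ne_zero.2 (hφ x)))
  set q : ℝ := max (1 - δ) 0
  have hq0 : 0 ≤ q := le_max_right _ _
  have hq1 : q < 1 := max_lt (by linarith) one_pos
  set e : ℝ := min (ε / 4) (1 / 4)
  have he : 0 < e := by positivity
  obtain ⟨n, hn, hnq, hnQ⟩ : ∃ n : ℕ, 0 < n ∧ q ^ n < e ∧ 1 / e < (1 + δ) ^ n :=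
    ((eventually_gt_atTop 0).and
      (((tendsto_pow_atTop_nhds_zero_of_lt_one hq0 hq1).eventually_lt_const he).and
        ((tendsto_pow_atTop_atTop_of_one_lt (by linarith : 1 < 1 + δ)).eventually_gt_atTop
          (1 / e)))).exists
  obtain ⟨w, hw⟩ := (isUnit_one_add_pow B φ hφ h1 hn).exists_right_inv
  have hwx : ∀ x, (1 + (φ : C(S, ℂ)) x ^ n) * (w : C(S, ℂ)) x = 1 := fun x =>
    DFunLike.congr_fun (congrArg Subtype.val hw) x
  have hee : e ≤ 1 / 4 := min_le_right _ _
  have heε : 4 * e ≤ ε := by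
    have : e ≤ ε / 4 := min_le_left _ _
    linarith
  refine ⟨w, w.2, fun x hx => ?_, fun x hx => ?_⟩
  · have h2 := hδφ x (mem_univ x)
    rw [abs_of_neg (by linarith)] at h2
    refine (norm_sub_one_lt_of_one_add_mul_eq_one hee ?_ (hwx x)).trans_le heε
    rw [norm_pow]
    exact (pow_le_pow_left₀ (norm_nonneg _) (le_max_of_le_left (by linarith)) n).trans_lt hnq
  · have h2 := hδφ x (mem_univ x)
    rw [abs_of_pos (by linarith)] at h2
    refine (norm_lt_of_one_add_mul_eq_one he hee ?_ (hwx x)).trans_le heε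
    rw [norm_pow]
    exact hnQ.trans_le (pow_le_pow_left₀ (by linarith) (by linarith) n)

lemma sq_mul_norm_inv_mul_sub_one_sq {c : ℝ} (hc : c ≠ 0) (z : ℂ) :
    c ^ 2 * ‖(c : ℂ)⁻¹ * z - 1‖ ^ 2 = ‖z‖ ^ 2 - 2 * c * z.re + c ^ 2 := by
  have hcC : (c : ℂ) ≠ 0 := by exact_mod_cast hc
  have h1 : (c : ℂ) * ((c : ℂ)⁻¹ * z - 1) = z - c := by field_simp
  have h2 : c ^ 2 * ‖(c : ℂ)⁻¹ * z - 1‖ ^ 2 = ‖z - c‖ ^ 2 := by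
    rw [← h1, norm_mul, Complex.norm_real, Real.norm_eq_abs, mul_pow, sq_abs]
  rw [h2, Complex.sq_norm, Complex.sq_norm, Complex.normSq_apply, Complex.normSq_apply]
  simp
  ring

/-- If the values of a member of a closed subalgebra avoid the imaginary axis, then the indicator
function of the part where the real part is positive can be approximated within the algebra. -/
lemma exists_mem_near_indicator {S : Type*} [TopologicalSpace S] [CompactSpace S]
    (B : Subalgebra ℂ C(S, ℂ)) [hB : IsClosed (B : Set C(S, ℂ))] {f : C(S, ℂ)} (hf : f ∈ B)
    (h0 : ∀ x, (f x).re ≠ 0) {ε : ℝ} (hε : 0 < ε) :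
    ∃ k ∈ B, (∀ x, 0 < (f x).re → ‖k x - 1‖ < ε) ∧ ∀ x, (f x).re < 0 → ‖k x‖ < ε := by
  rcases isEmpty_or_nonempty S with hS | hS
  · exact ⟨1, B.one_mem, fun x => hS.elim x, fun x => hS.elim x⟩
  have : CompleteSpace B := hB.completeSpace_coe
  obtain ⟨η, hη, hηf⟩ := isCompact_univ.exists_pos_forall_le_of_pos (φ := fun x : S => |(f x).re|)
    (by fun_prop) (fun x _ => abs_pos.2 (h0 x))
  -- The disc of centre and radius `c` contains the values in the right half-plane and misses
  -- those in the left one.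
  obtain ⟨c, hc0, hc1, hc2⟩ : ∃ c : ℝ, 0 < c ∧ ‖f‖ < 2 * c ∧ ‖f‖ ^ 2 < 2 * c * η := by
    refine ⟨‖f‖ ^ 2 / η + ‖f‖ + 1, by positivity, ?_, ?_⟩
    · have : 0 ≤ ‖f‖ ^ 2 / η := by positivity
      linarith [norm_nonneg f]
    · have : ‖f‖ ^ 2 / η * η = ‖f‖ ^ 2 := div_mul_cancel₀ _ hη.ne'
      nlinarith [norm_nonneg f, sq_nonneg ‖f‖, mul_nonneg (norm_nonneg f) hη.le]
  have hcC : (c : ℂ) ≠ 0 := by exact_mod_cast hc0.ne'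
  obtain ⟨fB, hfB⟩ : ∃ fB : B, (fB : C(S, ℂ)) = f := ⟨⟨f, hf⟩, rfl⟩
  have h2c : (2 * c : ℂ) ∉ spectrum ℂ fB := by
    intro h
    have h3 := B.norm_le_norm_coe_of_mem_spectrum h
    rw [hfB] at h3
    rw [norm_mul, Complex.norm_real, Real.norm_of_nonneg hc0.le, Complex.norm_two] at h3
    linarith
  obtain ⟨φ, hφ, hφx⟩ : ∃ φ : B, φ = (c : ℂ)⁻¹ • fB - 1 ∧
      ∀ x, (φ : C(S, ℂ)) x = (c : ℂ)⁻¹ * f x - 1 := ⟨_, rfl, fun x => by rw [← hfB]; rfl⟩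
  have hnorm : ∀ x, c ^ 2 * ‖(φ : C(S, ℂ)) x‖ ^ 2 = ‖f x‖ ^ 2 - 2 * c * (f x).re + c ^ 2 :=
    fun x => by rw [hφx, sq_mul_norm_inv_mul_sub_one_sq hc0.ne']
  have hright : ∀ x, 0 < (f x).re → ‖(φ : C(S, ℂ)) x‖ < 1 := by
    intro x hx
    have h1 := hηf x (mem_univ x)
    rw [abs_of_pos hx] at h1
    have h2 : ‖f x‖ ^ 2 ≤ ‖f‖ ^ 2 := by gcongr; exact f.norm_coe_le_norm x
    have h3 : c ^ 2 * ‖(φ : C(S, ℂ)) x‖ ^ 2 < c ^ 2 * 1 := by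
      rw [hnorm]; nlinarith
    exact (sq_lt_one_iff₀ (norm_nonneg _)).1 (lt_of_mul_lt_mul_left h3 (by positivity))
  have hleft : ∀ x, (f x).re < 0 → 1 < ‖(φ : C(S, ℂ)) x‖ := by
    intro x hx
    have h3 : c ^ 2 * 1 < c ^ 2 * ‖(φ : C(S, ℂ)) x‖ ^ 2 := by
      rw [hnorm]; nlinarith [sq_nonneg ‖f x‖]
    exact (one_lt_sq_iff₀ (norm_nonneg _)).1 (lt_of_mul_lt_mul_left h3 (by positivity))
  have hne : ∀ x, ‖(φ : C(S, ℂ)) x‖ ≠ 1 := fun x => by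
    rcases (h0 x).lt_or_gt with h | h
    · exact (hleft x h).ne'
    · exact (hright x h).ne
  have h1 : (1 : ℂ) ∉ spectrum ℂ φ := by
    rw [hφ]
    exact one_notMem_spectrum_smul_sub_one hcC h2c
  obtain ⟨k, hk, hk1, hk2⟩ := exists_mem_near_indicator_ball B φ hne h1 hε
  exact ⟨k, hk, fun x hx => hk1 x (hright x hx), fun x hx => hk2 x (hleft x hx)⟩

/-- The version of `exists_mem_near_indicator` on a closed subset `S` of the ambient space, for an
algebra that need not be closed. -/
lemma Subalgebra.exists_mem_near_indicator_on {X : Type*} [TopologicalSpace X] [CompactSpace X]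
    (A : Subalgebra ℂ C(X, ℂ)) {S : Set X} (hS : IsClosed S) {f : C(X, ℂ)} (hf : f ∈ A)
    (h0 : ∀ x ∈ S, (f x).re ≠ 0) {ε : ℝ} (hε : 0 < ε) :
    ∃ k ∈ A, (∀ x ∈ S, 0 < (f x).re → ‖k x - 1‖ < ε) ∧ ∀ x ∈ S, (f x).re < 0 → ‖k x‖ < ε := by
  have : CompactSpace S := isCompact_iff_compactSpace.1 hS.isCompact
  set ρ := ContinuousMap.compRightAlgHom ℂ ℂ (⟨Subtype.val, continuous_subtype_val⟩ : C(S, X))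
  set B := (A.map ρ).topologicalClosure
  have hB : IsClosed (B : Set C(S, ℂ)) := (A.map ρ).isClosed_topologicalClosure
  obtain ⟨k, hk, hk1, hk2⟩ := exists_mem_near_indicator B (f := ρ f)
    ((A.map ρ).le_topologicalClosure ⟨f, hf, rfl⟩) (fun x => h0 x x.2) (half_pos hε)
  obtain ⟨_, ⟨k', hk'A, rfl⟩, hk'⟩ := Metric.mem_closure_iff.1 hk (ε / 2) (half_pos hε)
  have hnear : ∀ x (hx : x ∈ S), ‖k' x - k ⟨x, hx⟩‖ < ε / 2 := fun x hx => by
    have := (ContinuousMap.dist_apply_le_dist (f := k) (g := ρ k') ⟨x, hx⟩).trans_lt hk'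
    rwa [dist_comm, dist_eq_norm] at this
  refine ⟨k', hk'A, fun x hx h => ?_, fun x hx h => ?_⟩
  · calc ‖k' x - 1‖ = ‖(k' x - k ⟨x, hx⟩) + (k ⟨x, hx⟩ - 1)‖ := by ring_nf
      _ ≤ _ := norm_add_le _ _
      _ < ε := by linarith [hnear x hx, hk1 ⟨x, hx⟩ h]
  · calc ‖k' x‖ = ‖(k' x - k ⟨x, hx⟩) + k ⟨x, hx⟩‖ := by ring_nf
      _ ≤ _ := norm_add_le _ _
      _ < ε := by linarith [hnear x hx, hk2 ⟨x, hx⟩ h]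

/-- A density criterion in the spirit of Bishop's theorem. Among the closed sets on which a given
function has distance at least `d` from the algebra there is a minimal one; a member of the algebra
splitting it into two clopen pieces allows approximants on the pieces to be glued, so the minimal
set is a singleton, where the constants already approximate. -/
lemma Subalgebra.dense_of_exists_split {X : Type*} [TopologicalSpace X] [CompactSpace X]
    (A : Subalgebra ℂ C(X, ℂ))
    (h : ∀ S : Set X, IsClosed S → S.Nontrivial → ∃ f ∈ A, (∀ x ∈ S, (f x).re ≠ 0) ∧
      (∃ x ∈ S, 0 < (f x).re) ∧ ∃ x ∈ S, (f x).re < 0) :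
    Dense (A : Set C(X, ℂ)) := by
  intro F
  by_contra hF
  rw [Metric.mem_closure_iff] at hF
  push Not at hF
  obtain ⟨d, hd, hdF⟩ := hF
  let 𝒮 : Set (Set X) := {S | IsClosed S ∧ ∀ g ∈ A, ∃ x ∈ S, d ≤ ‖F x - g x‖}
  have huniv : univ ∈ 𝒮 := by
    refine ⟨isClosed_univ, fun g hg => ?_⟩
    by_contra! hcon
    refine (hdF g hg).not_gt ((ContinuousMap.dist_lt_iff hd).2 fun x => ?_)
    rw [dist_eq_norm]
    exact hcon x (mem_univ x)
  obtain ⟨S, hSmin⟩ := zorn_superset 𝒮 (by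
    intro c hc hchain
    rcases c.eq_empty_or_nonempty with rfl | hcne
    · exact ⟨univ, huniv, by simp⟩
    refine ⟨⋂₀ c, ⟨isClosed_sInter fun s hs => (hc hs).1, fun g hg => ?_⟩,
      fun s hs => sInter_subset_of_mem hs⟩
    have hclosed : IsClosed {x | d ≤ ‖F x - g x‖} :=
      isClosed_le continuous_const (by fun_prop)
    have : Nonempty c := hcne.to_subtype
    have hne := IsCompact.nonempty_iInter_of_directed_nonempty_isCompact_isClosed
      (fun s : c => (s : Set X) ∩ {x | d ≤ ‖F x - g x‖})
      (by
        rintro ⟨s, hs⟩ ⟨t, ht⟩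
        rcases hchain.total hs ht with hst | hst
        · exact ⟨⟨s, hs⟩, le_rfl, inter_subset_inter_left _ hst⟩
        · exact ⟨⟨t, ht⟩, inter_subset_inter_left _ hst, le_rfl⟩)
      (fun s => (hc s.2).2 g hg)
      (fun s => ((hc s.2).1.inter hclosed).isCompact)
      (fun s => (hc s.2).1.inter hclosed)
    obtain ⟨x, hx⟩ := hne
    rw [mem_iInter] at hx
    exact ⟨x, fun s hs => (hx ⟨s, hs⟩).1, (hx (Classical.arbitrary c)).2⟩)
  have hSc := hSmin.prop.1
  have hSd := hSmin.prop.2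
  rcases S.subsingleton_or_nontrivial with hsub | hnt
  · obtain ⟨x, hx, -⟩ := hSd 0 A.zero_mem
    obtain ⟨y, hy, hyd⟩ := hSd (algebraMap ℂ _ (F x)) (A.algebraMap_mem _)
    rw [hsub hy hx] at hyd
    simp at hyd
    linarith
  · obtain ⟨f, hfA, hf0, ⟨p, hpS, hp⟩, q, hqS, hq⟩ := h S hSc hnt
    -- On a closed proper subset of `S` some member of the algebra approximates better than `d`.
    have key : ∀ E ⊆ S, IsClosed E → (∃ x ∈ S, x ∉ E) →
        ∃ g ∈ A, ∃ η > 0, ∀ x ∈ E, ‖F x - g x‖ ≤ d - η := by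
      rintro E hES hE ⟨x, hxS, hxE⟩
      have : E ∉ 𝒮 := fun hE' => hxE (hSmin.le_of_le hE' hES hxS)
      simp only [𝒮, mem_ofPred_eq, not_and, not_forall, not_exists] at this
      obtain ⟨g, hg, hgE⟩ := this hE
      obtain ⟨η, hη, hηE⟩ := hE.isCompact.exists_pos_forall_le_of_pos
        (φ := fun x => d - ‖F x - g x‖) (by fun_prop)
        (fun x hx => by have := hgE x; rw [not_le] at *; simpa [hx] using this)
      exact ⟨g, hg, η, hη, fun x hx => by linarith [hηE x hx]⟩
    obtain ⟨g₁, hg₁, η₁, hη₁, hE₁⟩ := key (S ∩ {x | 0 ≤ (f x).re}) inter_subset_left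
      (hSc.inter (isClosed_le continuous_const (by fun_prop))) ⟨q, hqS, by simp [hq]⟩
    obtain ⟨g₂, hg₂, η₂, hη₂, hE₂⟩ := key (S ∩ {x | (f x).re ≤ 0}) inter_subset_left
      (hSc.inter (isClosed_le (by fun_prop) continuous_const)) ⟨p, hpS, by simp [hp]⟩
    set M := ‖g₁ - g₂‖ + 1
    have hM : 0 < M := by positivity
    have hMx : ∀ x, ‖g₁ x - g₂ x‖ ≤ M := fun x =>
      ((g₁ - g₂).norm_coe_le_norm x).trans (by simp [M])
    set ε := min η₁ η₂ / M
    have hε : 0 < ε := div_pos (lt_min hη₁ hη₂) hM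
    have hεM : ε * M = min η₁ η₂ := div_mul_cancel₀ _ hM.ne'
    obtain ⟨k, hk, hk1, hk2⟩ := A.exists_mem_near_indicator_on hSc hfA hf0 hε
    have hsmall : ∀ (z : ℂ) x, ‖z‖ < ε → ‖z * (g₁ x - g₂ x)‖ < min η₁ η₂ := fun z x hz => by
      rw [norm_mul, ← hεM]
      calc _ ≤ ‖z‖ * M := by gcongr; exact hMx x
        _ < ε * M := by gcongr
    obtain ⟨x, hxS, hx⟩ := hSd (k * g₁ + (1 - k) * g₂)
      (A.add_mem (A.mul_mem hk hg₁) (A.mul_mem (A.sub_mem A.one_mem hk) hg₂))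
    simp only [ContinuousMap.add_apply, ContinuousMap.mul_apply, ContinuousMap.sub_apply,
      ContinuousMap.one_apply] at hx
    rcases (hf0 x hxS).lt_or_gt with hneg | hpos
    · have h1 := hE₂ x ⟨hxS, hneg.le⟩
      have h2 := hsmall _ x (hk2 x hxS hneg)
      have h3 := norm_sub_le (F x - g₂ x) (k x * (g₁ x - g₂ x))
      rw [show F x - g₂ x - k x * (g₁ x - g₂ x) = F x - (k x * g₁ x + (1 - k x) * g₂ x) by ring]
        at h3
      linarith [min_le_right η₁ η₂]
    · have h1 := hE₁ x ⟨hxS, hpos.le⟩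
      have h2 := hsmall _ x (hk1 x hxS hpos)
      have h3 := norm_sub_le (F x - g₁ x) ((k x - 1) * (g₁ x - g₂ x))
      rw [show F x - g₁ x - (k x - 1) * (g₁ x - g₂ x) = F x - (k x * g₁ x + (1 - k x) * g₂ x) by
        ring] at h3
      linarith [min_le_left η₁ η₂]

/-! ### Jumps of continuous functions on ordered spaces -/

/-- `TwoValued f ε I L R` says that on the set `I` the function `f` stays within `ε` of the two
values `L` and `R`, which either coincide or are within `ε` of the values of `f` at the two ends of
a jump of the order. -/
def TwoValued {X : Type*} [LinearOrder X] (f : X → ℝ) (ε : ℝ) (I : Set X) (L R : ℝ) : Prop :=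
  (∀ y ∈ I, |f y - L| < ε ∨ |f y - R| < ε) ∧
    (L = R ∨ ∃ a b, a ⋖ b ∧ |f a - L| < ε ∧ |f b - R| < ε)

/-- Two functions with the same two-valued approximate description differ, up to an error, by `0`
or by plus or minus a jump of the first one. -/
lemma TwoValued.sub_ne {X : Type*} [LinearOrder X] {f g : X → ℝ} {ε r L R : ℝ}
    {I : Set X} (hf : TwoValued f ε I L R)
    (hg : TwoValued g ε I L R) (hr0 : 5 * ε ≤ r)
    (hr : ∀ a b : X, a ⋖ b → 5 * ε ≤ |(|f b - f a|) - r|) {p : X} (hp : p ∈ I) :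
    f p - g p ≠ r := by
  intro heq
  have hv : ∃ v, 5 * ε ≤ |v - r| ∧ |(|R - L|) - v| ≤ 2 * ε ∧ 0 < ε := by
    have hε : 0 < ε := (hf.1 p hp).elim (fun h => (abs_nonneg _).trans_lt h)
      (fun h => (abs_nonneg _).trans_lt h)
    rcases hf.2 with rfl | ⟨a, b, hab, ha, hb⟩
    · exact ⟨0, by rw [zero_sub, abs_neg]; exact hr0.trans (le_abs_self r), by simp [hε.le], hε⟩
    · refine ⟨_, hr a b hab, (abs_abs_sub_abs_le _ _).trans ?_, hε⟩
      rw [abs_lt] at ha hb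
      rw [abs_le]
      constructor <;> linarith
  obtain ⟨v, hv1, hv2, hε⟩ := hv
  rcases abs_cases (v - r) with ⟨h1, h1'⟩ | ⟨h1, h1'⟩ <;>
  rcases abs_cases (|R - L| - v) with ⟨h2, h2'⟩ | ⟨h2, h2'⟩ <;>
  rcases abs_cases (R - L) with ⟨h3, h3'⟩ | ⟨h3, h3'⟩ <;>
  rcases hf.1 p hp with h4 | h4 <;> rcases hg.1 p hp with h5 | h5 <;>
  rw [abs_lt] at h4 h5 <;> linarith

section OrderedSpace

variable {X : Type*} [LinearOrder X] [TopologicalSpace X] [OrderTopology X]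

/-- Neighbourhoods of `a` reach down to a point of the dense set, unless `a` is the upper
but not the lower end of a jump. -/
lemma Dense.exists_Icc_subset_left {D : Set X} (hD : Dense D) (hbot : ∀ x, IsBot x → x ∈ D)
    {a : X} (ha : (∃ b, a ⋖ b) ∨ ¬ ∃ z, z ⋖ a) {U : Set X} (hU : U ∈ 𝓝 a) :
    ∃ d ∈ D, d ≤ a ∧ Icc d a ⊆ U ∧ Ici d ∈ 𝓝 a := by
  by_cases hb : IsBot a
  · refine ⟨a, hbot a hb, le_rfl, ?_, ?_⟩
    · simpa using mem_of_mem_nhds hU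
    · rw [show Ici a = univ from eq_univ_of_forall hb]
      exact univ_mem
  by_cases hz : ∃ z, z ⋖ a
  · obtain ⟨z, hz⟩ := hz
    obtain ⟨b, hb⟩ := ha.resolve_right (not_not.2 ⟨z, hz⟩)
    -- Here `a` is isolated, so it belongs to every dense set.
    obtain ⟨d, hd, hdD⟩ := hD.exists_mem_open (isOpen_Ioo (a := z) (b := b)) ⟨a, hz.lt, hb.lt⟩
    have hda : d = a := le_antisymm (hb.le_of_lt hdD.2) (hz.ge_of_gt hdD.1)
    subst hda
    refine ⟨d, hd, le_rfl, by simpa using mem_of_mem_nhds hU, ?_⟩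
    rw [← hz.Ioi_eq]
    exact Ioi_mem_nhds hz.lt
  · obtain ⟨l₀, hl₀⟩ := not_forall.1 hb
    rw [not_le] at hl₀
    obtain ⟨l, hl, hlU⟩ := exists_Ioc_subset_of_mem_nhds hU ⟨l₀, hl₀⟩
    have hne : (Ioo l a).Nonempty := by
      by_contra hcon
      exact hz ⟨l, hl, fun c h1 h2 => hcon ⟨c, h1, h2⟩⟩
    obtain ⟨d, hdD, hd⟩ := hD.exists_mem_open isOpen_Ioo hne
    exact ⟨d, hdD, hd.2.le, fun y hy => hlU ⟨hd.1.trans_le hy.1, hy.2⟩, Ici_mem_nhds hd.2⟩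

lemma Dense.exists_Icc_subset_right {D : Set X} (hD : Dense D) (htop : ∀ x, IsTop x → x ∈ D)
    {b : X} (hb : (∃ a, a ⋖ b) ∨ ¬ ∃ z, b ⋖ z) {U : Set X} (hU : U ∈ 𝓝 b) :
    ∃ d ∈ D, b ≤ d ∧ Icc b d ⊆ U ∧ Iic d ∈ 𝓝 b := by
  obtain ⟨d, hdD, hbd, hsub, hmem⟩ := Dense.exists_Icc_subset_left (X := Xᵒᵈ)
    (D := OrderDual.ofDual ⁻¹' D) hD (fun x hx => htop x.ofDual hx) (a := OrderDual.toDual b)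
    (hb.imp (fun ⟨a, h⟩ => ⟨OrderDual.toDual a, h.toDual⟩)
      (fun h ⟨z, hz⟩ => h ⟨z.ofDual, hz.ofDual⟩)) (U := OrderDual.ofDual ⁻¹' U) hU
  exact ⟨d.ofDual, hdD, hbd, fun y hy => hsub (a := OrderDual.toDual y) ⟨hy.2, hy.1⟩, hmem⟩

/-- On both sides of a jump `a ⋖ b` a continuous function is nearly constant on a neighbourhood
whose end points come from a given dense set. -/
lemma Dense.exists_Icc_near_of_covBy {D : Set X} (hD : Dense D) (hbot : ∀ x, IsBot x → x ∈ D)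
    (htop : ∀ x, IsTop x → x ∈ D) (f : C(X, ℝ)) {ε : ℝ} (hε : 0 < ε) {a b : X} (hab : a ⋖ b) :
    ∃ d ∈ D, ∃ e ∈ D, Icc d e ∈ 𝓝 a ∧ Icc d e ∈ 𝓝 b ∧
      (∀ y ∈ Icc d e, y ≤ a → |f y - f a| < ε) ∧ ∀ y ∈ Icc d e, b ≤ y → |f y - f b| < ε := by
  have hU : ∀ p, {y | |f y - f p| < ε} ∈ 𝓝 p := fun p =>
    (isOpen_lt (by fun_prop) continuous_const).mem_nhds (by simpa using hε)
  obtain ⟨d, hdD, hda, hsub, hmem⟩ := hD.exists_Icc_subset_left hbot (Or.inl ⟨b, hab⟩) (hU a)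
  obtain ⟨e, heD, hbe, hsub', hmem'⟩ := hD.exists_Icc_subset_right htop (Or.inl ⟨a, hab⟩) (hU b)
  refine ⟨d, hdD, e, heD, ?_, ?_, fun y hy hya => hsub ⟨hy.1, hya⟩,
    fun y hy hyb => hsub' ⟨hyb, hy.2⟩⟩
  · rw [← Ici_inter_Iic]
    refine inter_mem hmem (mem_of_superset (Iio_mem_nhds hab.lt) fun y hy => hy.le.trans hbe)
  · rw [← Ici_inter_Iic]
    refine inter_mem (mem_of_superset (Ioi_mem_nhds hab.lt) fun y hy => hda.trans hy.le) hmem'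

lemma Dense.exists_Icc_twoValued {D : Set X} (hD : Dense D) (hbot : ∀ x, IsBot x → x ∈ D)
    (htop : ∀ x, IsTop x → x ∈ D) (f : C(X, ℝ)) {ε : ℝ} (hε : 0 < ε) (p : X) :
    ∃ t : D × D × ℚ × ℚ, Icc (t.1 : X) t.2.1 ∈ 𝓝 p ∧
      TwoValued f ε (Icc (t.1 : X) t.2.1) t.2.2.1 t.2.2.2 := by
  have hrat : ∀ q, ∃ L : ℚ, |f q - L| < ε / 2 := fun q => exists_rat_near (f q) (half_pos hε)
  have hcov : ∀ a b, a ⋖ b → (p = a ∨ p = b) → ∃ t : D × D × ℚ × ℚ, Icc (t.1 : X) t.2.1 ∈ 𝓝 p ∧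
      TwoValued f ε (Icc (t.1 : X) t.2.1) t.2.2.1 t.2.2.2 := by
    intro a b hab hp
    obtain ⟨d, hd, e, he, ha, hb, h1, h2⟩ :=
      hD.exists_Icc_near_of_covBy hbot htop f (half_pos hε) hab
    obtain ⟨L, hL⟩ := hrat a
    obtain ⟨R, hR⟩ := hrat b
    refine ⟨⟨⟨d, hd⟩, ⟨e, he⟩, L, R⟩, ?_, fun y hy => ?_, Or.inr ⟨a, b, hab, ?_, ?_⟩⟩
    · rcases hp with rfl | rfl
      exacts [ha, hb]
    · rcases le_or_gt y a with hya | hya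
      · left
        have := abs_sub_le (f y) (f a) L
        linarith [h1 y hy hya]
      · right
        have := abs_sub_le (f y) (f b) R
        linarith [h2 y hy (hab.ge_of_gt hya)]
    · exact hL.trans (half_lt_self hε)
    · exact hR.trans (half_lt_self hε)
  by_cases h1 : ∃ b, p ⋖ b
  · obtain ⟨b, hb⟩ := h1
    exact hcov p b hb (Or.inl rfl)
  by_cases h2 : ∃ a, a ⋖ p
  · obtain ⟨a, ha⟩ := h2
    exact hcov a p ha (Or.inr rfl)
  have hU : {y | |f y - f p| < ε / 2} ∈ 𝓝 p :=
    (isOpen_lt (by fun_prop) continuous_const).mem_nhds (by simpa using hε)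
  obtain ⟨d, hdD, hda, hsub, hmem⟩ := hD.exists_Icc_subset_left hbot (Or.inr h2) hU
  obtain ⟨e, heD, hbe, hsub', hmem'⟩ := hD.exists_Icc_subset_right htop (Or.inr h1) hU
  obtain ⟨L, hL⟩ := hrat p
  refine ⟨⟨⟨d, hdD⟩, ⟨e, heD⟩, L, L⟩, ?_, fun y hy => Or.inl ?_, Or.inl rfl⟩
  · rw [← Ici_inter_Iic]
    exact inter_mem hmem hmem'
  · have h3 : |f y - f p| < ε / 2 := by
      rcases le_total y p with h | h
      · exact hsub ⟨hy.1, h⟩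
      · exact hsub' ⟨h, hy.2⟩
    have := abs_sub_le (f y) (f p) L
    linarith

variable [CompactSpace X]

lemma Dense.exists_finset_twoValued {D : Set X} (hD : Dense D) (hbot : ∀ x, IsBot x → x ∈ D)
    (htop : ∀ x, IsTop x → x ∈ D) (f : C(X, ℝ)) {ε : ℝ} (hε : 0 < ε) :
    ∃ T : Finset (D × D × ℚ × ℚ), (∀ p : X, ∃ t ∈ T, p ∈ Icc (t.1 : X) t.2.1) ∧
      ∀ t ∈ T, TwoValued f ε (Icc (t.1 : X) t.2.1) t.2.2.1 t.2.2.2 := by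
  classical
  choose t ht ht' using hD.exists_Icc_twoValued hbot htop f hε
  obtain ⟨s, hs⟩ := CompactSpace.elim_nhds_subcover (fun p => Icc ((t p).1 : X) (t p).2.1) ht
  refine ⟨s.image t, fun p => ?_, fun u hu => ?_⟩
  · have hp : p ∈ ⋃ x ∈ s, Icc ((t x).1 : X) (t x).2.1 := hs ▸ mem_univ p
    simp only [mem_iUnion] at hp
    obtain ⟨x, hx, hpx⟩ := hp
    exact ⟨t x, Finset.mem_image_of_mem t hx, hpx⟩
  · obtain ⟨x, -, rfl⟩ := Finset.mem_image.1 hu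
    exact ht' x

/-- A continuous function has only finitely many jumps of at least a given size, since these cannot
accumulate. -/
lemma finite_large_jumps (f : C(X, ℝ)) {δ : ℝ} (hδ : 0 < δ) :
    {a : X | ∃ b, a ⋖ b ∧ δ ≤ |f b - f a|}.Finite := by
  by_contra hinf
  obtain ⟨p, hp⟩ := (show Set.Infinite _ from hinf).exists_accPt_principal
  set U := ordConnectedComponent {y | |f y - f p| < δ / 2} p
  have hU : U ∈ 𝓝 p := ordConnectedComponent_mem_nhds.2
    ((isOpen_lt (by fun_prop) continuous_const).mem_nhds (by simpa using hδ))
  have hUord : OrdConnected U := inferInstance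
  have hUf : ∀ y ∈ U, |f y - f p| < δ / 2 := fun y hy =>
    ordConnectedComponent_subset (s := {y | |f y - f p| < δ / 2}) hy
  -- Two jump points in `U` put both ends of the lower jump into `U`.
  have key : ∀ a ∈ U, ∀ a' ∈ U, a < a' → ¬ ∃ b, a ⋖ b ∧ δ ≤ |f b - f a| := by
    rintro a ha a' ha' hlt ⟨b, hab, hb⟩
    have hbU : b ∈ U := hUord.out ha ha' ⟨hab.le, hab.ge_of_gt hlt⟩
    have h1 := hUf a ha
    rw [abs_sub_comm] at h1
    linarith [hUf b hbU, abs_sub_le (f b) (f p) (f a)]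
  rw [accPt_iff_nhds] at hp
  obtain ⟨a, ⟨haU, ha⟩, hap⟩ := hp U hU
  obtain ⟨a', ⟨ha'U, ha'⟩, ha'p⟩ := hp (U ∩ {a}ᶜ)
    (inter_mem hU (isOpen_compl_singleton.mem_nhds (by simpa using hap.symm)))
  rcases lt_or_gt_of_ne (show a' ≠ a from ha'U.2) with h | h
  · exact key a' ha'U.1 a haU h ha'
  · exact key a haU a' ha'U.1 h ha

/-- Some rational level between `0` and `1` keeps a definite distance from the sizes of all jumps
of a given continuous function. -/
lemma exists_rat_level_avoiding_jumps (f : C(X, ℝ)) :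
    ∃ r ε : ℚ, 0 < ε ∧ 5 * ε ≤ r ∧ r + ε ≤ 1 ∧
      ∀ a b : X, a ⋖ b → 5 * (ε : ℝ) ≤ |(|f b - f a|) - r| := by
  have hfin := finite_large_jumps f (δ := 1 / 4) (by norm_num)
  have hV : {v : ℝ | ∃ a b : X, a ⋖ b ∧ 1 / 4 ≤ |f b - f a| ∧ v = |f b - f a|}.Finite := by
    classical
    have hsub : {v : ℝ | ∃ a b : X, a ⋖ b ∧ 1 / 4 ≤ |f b - f a| ∧ v = |f b - f a|} ⊆
        (fun a => if h : ∃ b, a ⋖ b then |f h.choose - f a| else 0) ''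
          {a : X | ∃ b, a ⋖ b ∧ 1 / 4 ≤ |f b - f a|} := by
      rintro v ⟨a, b, hab, hle, rfl⟩
      refine ⟨a, ⟨b, hab, hle⟩, ?_⟩
      have h : ∃ b, a ⋖ b := ⟨b, hab⟩
      have hb : h.choose = b := h.choose_spec.unique_right hab
      simp only [dif_pos h, hb]
    exact (hfin.image _).subset hsub
  set V := {v : ℝ | ∃ a b : X, a ⋖ b ∧ 1 / 4 ≤ |f b - f a| ∧ v = |f b - f a|}
  obtain ⟨r, ⟨hr1, hr2⟩, hrV⟩ : ∃ r : ℚ, ((1 / 2 : ℝ) < r ∧ (r : ℝ) < 3 / 4) ∧ (r : ℝ) ∉ V := by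
    have hinf : ((Ioo (1 / 2 : ℚ) (3 / 4)).image ((↑) : ℚ → ℝ)).Infinite :=
      (Ioo_infinite (by norm_num)).image Rat.cast_injective.injOn
    obtain ⟨_, ⟨r, hr, rfl⟩, hrV⟩ := hinf.exists_notMem_finite hV
    refine ⟨r, ⟨?_, ?_⟩, hrV⟩
    · have := (Rat.cast_lt (K := ℝ)).2 hr.1
      push_cast at this; linarith
    · have := (Rat.cast_lt (K := ℝ)).2 hr.2
      push_cast at this; linarith
  obtain ⟨η, hη, hηV⟩ := hV.isCompact.exists_pos_forall_le_of_pos (φ := fun v => |v - r|)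
    (by fun_prop) (fun v hv => abs_pos.2 (sub_ne_zero.2 fun h => hrV (h ▸ hv)))
  obtain ⟨ε, hε0, hε⟩ := exists_rat_btwn (show (0 : ℝ) < min (η / 5) (1 / 20) by positivity)
  have hε1 : (ε : ℝ) < η / 5 := hε.trans_le (min_le_left _ _)
  have hε2 : (ε : ℝ) < 1 / 20 := hε.trans_le (min_le_right _ _)
  refine ⟨r, ε, by exact_mod_cast hε0, ?_, ?_, fun a b hab => ?_⟩
  · rw [← Rat.cast_le (K := ℝ)]; push_cast; linarith
  · rw [← Rat.cast_le (K := ℝ)]; push_cast; linarith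
  · by_cases h : 1 / 4 ≤ |f b - f a|
    · have := hηV _ ⟨a, b, hab, h, rfl⟩
      linarith
    · rw [not_le] at h
      rw [abs_sub_comm]
      exact le_trans (by linarith) (le_abs_self _)

/-- From an uncountable set of jumps and functions separating their ends, two functions can be
chosen whose difference avoids some level `r` but lies on both sides of `r`. Each function has an
approximate description by finitely many rational data; two of them share it. -/
lemma exists_sub_avoids_level [TopologicalSpace.SeparableSpace X] {J : Set X}
    (hJ : ¬ J.Countable) (s : X → X) (h : X → C(X, ℝ)) (hs : ∀ x ∈ J, x ⋖ s x)
    (h0 : ∀ x ∈ J, h x x = 0) (h1 : ∀ x ∈ J, h x (s x) = 1) :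
    ∃ x ∈ J, ∃ y ∈ J, ∃ r : ℝ, (∀ p, h x p - h y p ≠ r) ∧ h x x - h y x < r ∧
      r < h x (s x) - h y (s x) := by
  obtain ⟨D₀, hD₀c, hD₀⟩ := TopologicalSpace.exists_countable_dense X
  set D : Set X := D₀ ∪ ({x | IsBot x} ∪ {x | IsTop x})
  have hD : Dense D := hD₀.mono subset_union_left
  have hDc : D.Countable := hD₀c.union
    ((subsingleton_isBot X).countable.union (subsingleton_isTop X).countable)
  have hbot : ∀ x, IsBot x → x ∈ D := fun x hx => Or.inr (Or.inl hx)
  have htop : ∀ x, IsTop x → x ∈ D := fun x hx => Or.inr (Or.inr hx)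
  have : Countable D := hDc.to_subtype
  have hdata : ∀ x : J, ∃ τ : ℚ × ℚ × Finset (D × D × ℚ × ℚ) × D × D,
      (0 < τ.2.1 ∧ 5 * τ.2.1 ≤ τ.1 ∧ τ.1 + τ.2.1 ≤ 1 ∧
        ∀ a b : X, a ⋖ b → 5 * (τ.2.1 : ℝ) ≤ |(|h x b - h x a|) - τ.1|) ∧
      ((∀ p : X, ∃ t ∈ τ.2.2.1, p ∈ Icc (t.1 : X) t.2.1) ∧
        ∀ t ∈ τ.2.2.1, TwoValued (h x) τ.2.1 (Icc (t.1 : X) t.2.1) t.2.2.1 t.2.2.2) ∧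
      (x : X) ∈ Icc (τ.2.2.2.1 : X) τ.2.2.2.2 ∧
      (∀ y ∈ Icc (τ.2.2.2.1 : X) τ.2.2.2.2, y ≤ x → |h x y| < τ.2.1) := by
    rintro ⟨x, hx⟩
    obtain ⟨r, ε, hε, hr0, hr1, hr⟩ := exists_rat_level_avoiding_jumps (h x)
    have hε' : (0 : ℝ) < ε := by exact_mod_cast hε
    obtain ⟨T, hT⟩ := hD.exists_finset_twoValued hbot htop (h x) hε'
    obtain ⟨d, hd, e, he, hxI, -, hd1, -⟩ :=
      hD.exists_Icc_near_of_covBy hbot htop (h x) hε' (hs x hx)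
    refine ⟨⟨r, ε, T, ⟨d, hd⟩, ⟨e, he⟩⟩, ⟨hε, hr0, hr1, hr⟩, hT, mem_of_mem_nhds hxI,
      fun y hy hyx => ?_⟩
    simpa [h0 x hx] using hd1 y hy hyx
  choose τ hτ using hdata
  have hninj : ¬ Function.Injective τ := fun hinj => hJ (hinj.countable)
  obtain ⟨x, y, hxy, hne⟩ : ∃ x y : J, τ x = τ y ∧ x < y := by
    simp only [Function.Injective, not_forall] at hninj
    obtain ⟨x, y, hxy, hne⟩ := hninj
    rcases lt_or_gt_of_ne hne with h | h
    exacts [⟨x, y, hxy, h⟩, ⟨y, x, hxy.symm, h⟩]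
  obtain ⟨⟨hε, hr0, hr1, hr⟩, ⟨hT1, hT2⟩, hxI, hx0⟩ := hτ x
  obtain ⟨-, ⟨-, hT2'⟩, hyI, hy0⟩ := hτ y
  rw [← hxy] at hT2' hyI hy0
  have hr0' : 5 * ((τ x).2.1 : ℝ) ≤ (τ x).1 := by exact_mod_cast hr0
  have hr1' : ((τ x).1 : ℝ) + (τ x).2.1 ≤ 1 := by exact_mod_cast hr1
  have hε' : (0 : ℝ) < (τ x).2.1 := by exact_mod_cast hε
  refine ⟨x, x.2, y, y.2, (τ x).1, fun p => ?_, ?_, ?_⟩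
  · obtain ⟨t, ht, hp⟩ := hT1 p
    exact (hT2 t ht).sub_ne (hT2' t ht) hr0' hr hp
  · have h2 := hy0 x hxI hne.le
    rw [abs_lt] at h2
    rw [h0 x x.2]
    linarith
  · have hsy : s x ≤ y := (hs x x.2).ge_of_gt hne
    have h2 := hy0 (s x) ⟨hxI.1.trans (hs x x.2).le, hsy.trans hyI.2⟩ hsy
    rw [abs_lt] at h2
    rw [h1 x x.2]
    linarith

/-- In a separable ordered space, an uncountable compact set with only countably many jumps of the
ambient order is second countable, hence contains a Cantor set. -/
lemma containsCantorSet_of_countable_jumps [TopologicalSpace.SeparableSpace X] {S : Set X}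
    (hS : IsClosed S) (hunc : ¬ S.Countable)
    (hJ : {x | x ∈ S ∧ ∃ y ∈ S, x ⋖ y}.Countable) : ContainsCantorSet X := by
  obtain ⟨D, hDc, hD⟩ := TopologicalSpace.exists_countable_dense X
  set J := {x | x ∈ S ∧ ∃ y ∈ S, x ⋖ y}
  have hScpt : CompactSpace S := isCompact_iff_compactSpace.1 hS.isCompact
  -- A countable family of open sets of `S` separating points generates a coarser Hausdorff
  -- topology, which agrees with the compact topology of `S`.
  let 𝓕 : Set (Set S) :=
    ((fun d => {y : S | (y : X) < d}) '' D ∪ (fun d => {y : S | d < (y : X)}) '' D) ∪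
    ((fun d => {y : S | (y : X) ≤ d}) '' J ∪ (fun d => {y : S | d < (y : X)}) '' J)
  have h𝓕c : 𝓕.Countable :=
    ((hDc.image _).union (hDc.image _)).union ((hJ.image _).union (hJ.image _))
  have h𝓕o : ∀ U ∈ 𝓕, IsOpen U := by
    rintro U ((⟨d, -, rfl⟩ | ⟨d, -, rfl⟩) | (⟨d, ⟨-, e, -, hde⟩, rfl⟩ | ⟨d, -, rfl⟩))
    · exact isOpen_Iio.preimage continuous_subtype_val
    · exact isOpen_Ioi.preimage continuous_subtype_val
    · have : {y : S | (y : X) ≤ d} = Subtype.val ⁻¹' Iio e := by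
        rw [hde.Iio_eq]; rfl
      simp only [this]
      exact isOpen_Iio.preimage continuous_subtype_val
    · exact isOpen_Ioi.preimage continuous_subtype_val
  have hsep : ∀ p q : S, p < q → ∃ U ∈ 𝓕, ∃ V ∈ 𝓕, p ∈ U ∧ q ∈ V ∧ Disjoint U V := by
    intro p q hpq
    by_cases hne : (Ioo (p : X) q).Nonempty
    · obtain ⟨d, hdD, hd⟩ := hD.exists_mem_open isOpen_Ioo hne
      refine ⟨_, Or.inl (Or.inl ⟨d, hdD, rfl⟩), _, Or.inl (Or.inr ⟨d, hdD, rfl⟩), hd.1, hd.2, ?_⟩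
      exact disjoint_left.2 fun y hy hy' => lt_asymm hy hy'
    · have hcov : (p : X) ⋖ q := ⟨hpq, fun c h1 h2 => hne ⟨c, h1, h2⟩⟩
      have hpJ : (p : X) ∈ J := ⟨p.2, q, q.2, hcov⟩
      refine ⟨_, Or.inr (Or.inl ⟨p, hpJ, rfl⟩), _, Or.inr (Or.inr ⟨p, hpJ, rfl⟩), le_rfl, hpq, ?_⟩
      exact disjoint_left.2 fun y hy hy' => hy.not_gt hy'
  have hle : (instTopologicalSpaceSubtype : TopologicalSpace S) ≤
      TopologicalSpace.generateFrom 𝓕 := le_generateFrom h𝓕o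
  have hT2 : @T2Space S (TopologicalSpace.generateFrom 𝓕) := by
    refine @T2Space.mk S (TopologicalSpace.generateFrom 𝓕) fun p q hpq => ?_
    rcases lt_or_gt_of_ne hpq with h | h
    · obtain ⟨U, hU, V, hV, hp, hq, hd⟩ := hsep p q h
      exact ⟨U, V, TopologicalSpace.isOpen_generateFrom_of_mem hU,
        TopologicalSpace.isOpen_generateFrom_of_mem hV, hp, hq, hd⟩
    · obtain ⟨U, hU, V, hV, hp, hq, hd⟩ := hsep q p h
      exact ⟨V, U, TopologicalSpace.isOpen_generateFrom_of_mem hV,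
        TopologicalSpace.isOpen_generateFrom_of_mem hU, hq, hp, hd.symm⟩
  have heq : (instTopologicalSpaceSubtype : TopologicalSpace S) =
      TopologicalSpace.generateFrom 𝓕 := by
    refine le_antisymm hle ?_
    have hc : @Continuous S S instTopologicalSpaceSubtype (TopologicalSpace.generateFrom 𝓕) id :=
      continuous_id_iff_le.2 hle
    have hclosed := @Continuous.isClosedMap S S instTopologicalSpaceSubtype
      (TopologicalSpace.generateFrom 𝓕) _ hT2 id hc
    intro U hU
    have h1 := hclosed Uᶜ (@IsOpen.isClosed_compl S instTopologicalSpaceSubtype U hU)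
    rw [image_id] at h1
    exact (@isClosed_compl_iff S (TopologicalSpace.generateFrom 𝓕) U).1 h1
  have hsc : SecondCountableTopology S := ⟨𝓕, h𝓕c, heq⟩
  have hmet : TopologicalSpace.MetrizableSpace S :=
    TopologicalSpace.metrizableSpace_of_t3_secondCountable S
  let : MetricSpace S := TopologicalSpace.metrizableSpaceMetric S
  obtain ⟨f, -, hfc, hfi⟩ := (isClosed_univ (X := S)).exists_nat_bool_injection_of_not_countable
    (fun h => hunc (by simpa [countable_univ_iff] using h))
  exact ⟨fun z => (f (cantorSetHomeomorphNatToBool z) : X), IsEmbedding.subtypeVal.comp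
    ((hfc.isClosedEmbedding hfi).isEmbedding.comp cantorSetHomeomorphNatToBool.isEmbedding)⟩

lemma exists_mem_apply_eq_zero_one {Y : Type*} [TopologicalSpace Y] {A : Subalgebra ℂ C(Y, ℂ)}
    (hA : A.SeparatesPoints) {p q : Y} (hpq : p ≠ q) : ∃ f ∈ A, f p = 0 ∧ f q = 1 := by
  obtain ⟨_, ⟨f, hf, rfl⟩, hne⟩ := hA hpq
  have hne' : f q - f p ≠ 0 := sub_ne_zero.2 (Ne.symm hne)
  refine ⟨(f q - f p)⁻¹ • (f - algebraMap ℂ _ (f p)),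
    A.smul_mem (A.sub_mem hf (A.algebraMap_mem _)) _, by simp, ?_⟩
  simp [hne']

theorem hasCSWP_of_not_containsCantorSet [TopologicalSpace.SeparableSpace X]
    (hX : ¬ ContainsCantorSet X) : HasCSWP X := by
  intro A hA
  -- It suffices to find a level that the real part of some member of `A` crosses but avoids.
  have hlevel : ∀ S : Set X, (∃ f ∈ A, ∃ r : ℝ, (∀ x ∈ S, (f x).re ≠ r) ∧
      (∃ x ∈ S, r < (f x).re) ∧ ∃ x ∈ S, (f x).re < r) → ∃ f ∈ A, (∀ x ∈ S, (f x).re ≠ 0) ∧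
      (∃ x ∈ S, 0 < (f x).re) ∧ ∃ x ∈ S, (f x).re < 0 := by
    rintro S ⟨f, hf, r, h1, ⟨p, hpS, hp⟩, q, hqS, hq⟩
    refine ⟨f - algebraMap ℂ _ (r : ℂ), A.sub_mem hf (A.algebraMap_mem _), fun x hx => ?_,
      ⟨p, hpS, ?_⟩, q, hqS, ?_⟩
    · simpa [sub_eq_zero] using h1 x hx
    · simpa using hp
    · simpa using hq
  refine A.dense_of_exists_split fun S hS hnt => hlevel S ?_
  by_cases hSc : S.Countable
  · obtain ⟨p, hp, q, hq, hpq⟩ := hnt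
    obtain ⟨f, hf, hfp, hfq⟩ := exists_mem_apply_eq_zero_one hA hpq
    obtain ⟨r, ⟨hr0, hr1⟩, hr⟩ : (Ioo (0 : ℝ) 1 \ (fun x => (f x).re) '' S).Nonempty := by
      by_contra hcon
      rw [not_nonempty_iff_eq_empty, sdiff_eq_empty] at hcon
      exact Cardinal.Real.Ioo_countable_iff.not.2 (by norm_num) ((hSc.image _).mono hcon)
    exact ⟨f, hf, r, fun x hx h => hr ⟨x, hx, h⟩, ⟨q, hq, by simpa [hfq] using hr1⟩,
      p, hp, by simpa [hfp] using hr0⟩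
  · have hJ : ¬ {x | x ∈ S ∧ ∃ y ∈ S, x ⋖ y}.Countable := fun hJ =>
      hX (containsCantorSet_of_countable_jumps hS hSc hJ)
    set J := {x | x ∈ S ∧ ∃ y ∈ S, x ⋖ y}
    have hdata : ∀ x, ∃ y, ∃ f ∈ A, x ∈ J → y ∈ S ∧ x ⋖ y ∧ f x = 0 ∧ f y = 1 := by
      intro x
      by_cases hx : x ∈ J
      · obtain ⟨y, hy, hxy⟩ := hx.2
        obtain ⟨f, hf, hfx, hfy⟩ := exists_mem_apply_eq_zero_one hA hxy.lt.ne
        exact ⟨y, f, hf, fun _ => ⟨hy, hxy, hfx, hfy⟩⟩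
      · exact ⟨x, 0, A.zero_mem, fun h => absurd h hx⟩
    choose s f hf hsf using hdata
    obtain ⟨x, hx, y, -, r, hne, hlt, hgt⟩ := exists_sub_avoids_level hJ s
      (fun x => ⟨fun p => (f x p).re, by fun_prop⟩) (fun x hx => (hsf x hx).2.1)
      (fun x hx => by simp [(hsf x hx).2.2.1]) (fun x hx => by simp [(hsf x hx).2.2.2])
    exact ⟨f x - f y, A.sub_mem (hf x) (hf y), r, fun p _ => hne p,
      ⟨s x, (hsf x hx).1, hgt⟩, x, hx.1, hlt⟩

end OrderedSpace

/-! ### The Cauchy transform of a planar set of positive area -/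

section CauchyTransform

open MeasureTheory

lemma exists_isCompact_irrational_re_im :
    ∃ K : Set ℂ, IsCompact K ∧ 0 < volume K ∧ ∀ z ∈ K, Irrational z.re ∧ Irrational z.im := by
  have hae : ∀ᵐ x : ℝ, Irrational x := by
    have : (range ((↑) : ℚ → ℝ)).Countable := countable_range _
    exact this.ae_notMem volume
  have hpos : 0 < volume {x : ℝ | Irrational x} := by
    rw [measure_congr (eventuallyEq_univ.2 hae)]
    simp
  have hmeas : MeasurableSet {x : ℝ | Irrational x} :=
    (countable_range ((↑) : ℚ → ℝ)).measurableSet.compl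
  obtain ⟨F, hFsub, hF, hF0⟩ := hmeas.exists_lt_isCompact hpos
  refine ⟨Complex.measurableEquivRealProd ⁻¹' (F ×ˢ F), ?_, ?_,
    fun z hz => ⟨hFsub hz.1, hFsub hz.2⟩⟩
  · exact Complex.equivRealProdCLM.toHomeomorph.isCompact_preimage.2 (hF.prod hF)
  · rw [Complex.volume_preserving_equiv_real_prod.measure_preimage_equiv, Measure.volume_eq_prod,
      Measure.prod_prod]
    exact ENNReal.mul_pos hF0.ne' hF0.ne'

/-- The Cauchy transform of (the indicator function of) a set in the plane. -/
noncomputable def cauchyTransform (K : Set ℂ) (z : ℂ) : ℂ := ∫ w in K, (w - z)⁻¹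

lemma integrable_indicator_ball_norm_inv (ε : ℝ) :
    Integrable ((Metric.ball (0 : ℂ) ε).indicator fun u => ‖u‖⁻¹) := by
  rw [integrable_indicator_iff Metric.isOpen_ball.measurableSet]
  refine integrableOn_ball_of_norm_le_rpow (C := 1) (α := 1) ?_ ?_ ?_ ?_
  · rw [Complex.finrank_real_complex]; norm_num
  · rw [Complex.finrank_real_complex]; norm_num
  · exact ae_of_all _ fun x => by rw [Real.rpow_neg_one]; simp
  · exact measurable_norm.inv.aestronglyMeasurable

lemma integrableOn_sub_inv {K : Set ℂ} (hK : IsCompact K) (z : ℂ) :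
    IntegrableOn (fun w => (w - z)⁻¹) K := by
  have h1 := ((integrable_indicator_ball_norm_inv 1).comp_sub_right z).integrableOn (s := K)
  have h2 : IntegrableOn (fun _ : ℂ => (1 : ℝ)) K := integrableOn_const hK.measure_lt_top.ne
  refine Integrable.mono' (h1.add h2)
    (measurable_id.sub_const z).inv.aestronglyMeasurable (ae_of_all _ fun w => ?_)
  rw [norm_inv]
  by_cases h : w - z ∈ Metric.ball (0 : ℂ) 1
  · simp [indicator_of_mem h]
  · simp only [Pi.add_apply, indicator_of_notMem h, zero_add]
    rw [mem_ball_zero_iff, not_lt] at h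
    exact inv_le_one_of_one_le₀ h

/-- The kernel `u⁻¹` is the limit of the continuous kernels `conj u / max (‖u‖ ^ 2) (ε ^ 2)`; the
error is integrable, and its integral is small uniformly in the translation. -/
lemma continuous_cauchyTransform {K : Set ℂ} (hK : IsCompact K) :
    Continuous (cauchyTransform K) := by
  have hKfin : IsFiniteMeasure (volume.restrict K) := ⟨by simpa using hK.measure_lt_top⟩
  let k : ℝ → ℂ → ℂ := fun ε u => star u / ((max (‖u‖ ^ 2) (ε ^ 2) : ℝ) : ℂ)
  have hmax : ∀ ε > 0, ∀ u : ℂ, 0 < max (‖u‖ ^ 2) (ε ^ 2) := fun ε hε u =>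
    lt_max_of_lt_right (by positivity)
  have hkc : ∀ ε > 0, Continuous (k ε) := fun ε hε => by
    refine continuous_star.div (by fun_prop) fun u => ?_
    exact_mod_cast (hmax ε hε u).ne'
  have hkbd : ∀ ε > 0, ∀ u, ‖k ε u‖ ≤ ε⁻¹ := fun ε hε u => by
    simp only [k, norm_div, norm_star, Complex.norm_real, Real.norm_of_nonneg (hmax ε hε u).le]
    rw [div_le_iff₀ (hmax ε hε u), ← div_eq_inv_mul, le_div_iff₀ hε]
    rcases le_total ‖u‖ ε with h | h
    · exact le_max_of_le_right (by nlinarith [norm_nonneg u])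
    · exact le_max_of_le_left (by nlinarith [norm_nonneg u])
  have hkerr : ∀ ε > 0, ∀ u, ‖k ε u - u⁻¹‖ ≤
      (Metric.ball (0 : ℂ) ε).indicator (fun u => ‖u‖⁻¹) u := by
    intro ε hε u
    rcases eq_or_ne u 0 with rfl | hu
    · simpa [k] using indicator_nonneg (fun u _ => inv_nonneg.2 (norm_nonneg u)) (0 : ℂ)
    have hu' : 0 < ‖u‖ := norm_pos_iff.2 hu
    have hinv : u⁻¹ = star u * (((‖u‖ ^ 2)⁻¹ : ℝ) : ℂ) := by
      rw [Complex.inv_def, Complex.normSq_eq_norm_sq]; rfl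
    have heq : ‖k ε u - u⁻¹‖ = ‖u‖ * |(max (‖u‖ ^ 2) (ε ^ 2))⁻¹ - (‖u‖ ^ 2)⁻¹| := by
      simp only [k]
      rw [hinv, div_eq_mul_inv, ← Complex.ofReal_inv, ← mul_sub, ← Complex.ofReal_sub, norm_mul,
        norm_star, Complex.norm_real, Real.norm_eq_abs]
    rw [heq]
    by_cases h : ‖u‖ < ε
    · rw [indicator_of_mem (by simpa using h)]
      have h1 : (max (‖u‖ ^ 2) (ε ^ 2))⁻¹ ≤ (‖u‖ ^ 2)⁻¹ :=
        inv_anti₀ (by positivity) (le_max_left _ _)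
      have h2 : 0 < (max (‖u‖ ^ 2) (ε ^ 2))⁻¹ := inv_pos.2 (hmax ε hε u)
      rw [abs_of_nonpos (by linarith)]
      calc _ ≤ ‖u‖ * (‖u‖ ^ 2)⁻¹ := by gcongr; linarith
        _ = ‖u‖⁻¹ := by field_simp
    · rw [indicator_of_notMem (by simpa using h), max_eq_left]
      · simp
      · rw [not_lt] at h; gcongr
  have hkint : ∀ ε > 0, ∀ z, IntegrableOn (fun w => k ε (w - z)) K := fun ε hε z =>
    Integrable.of_bound ((hkc ε hε).comp (continuous_id.sub continuous_const)).aestronglyMeasurable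
      ε⁻¹ (ae_of_all _ fun w => hkbd ε hε _)
  have hkcont : ∀ ε > 0, Continuous fun z => ∫ w in K, k ε (w - z) := fun ε hε =>
    continuous_of_dominated (bound := fun _ => ε⁻¹) (fun z => (hkint ε hε z).aestronglyMeasurable)
      (fun z => ae_of_all _ fun w => hkbd ε hε _) (integrable_const _)
      (ae_of_all _ fun w => (hkc ε hε).comp (continuous_const.sub continuous_id))
  have herr : ∀ ε > 0, ∀ z, dist (cauchyTransform K z) (∫ w in K, k ε (w - z)) ≤
      ∫ u, (Metric.ball (0 : ℂ) ε).indicator (fun u => ‖u‖⁻¹) u := by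
    intro ε hε z
    rw [dist_comm, dist_eq_norm, cauchyTransform,
      ← integral_sub (hkint ε hε z) (integrableOn_sub_inv hK z)]
    have hI := (integrable_indicator_ball_norm_inv ε).comp_sub_right z
    calc _ ≤ ∫ w in K, (Metric.ball (0 : ℂ) ε).indicator (fun u => ‖u‖⁻¹) (w - z) :=
          norm_integral_le_of_norm_le hI.integrableOn (ae_of_all _ fun w => hkerr ε hε _)
      _ ≤ ∫ w, (Metric.ball (0 : ℂ) ε).indicator (fun u => ‖u‖⁻¹) (w - z) :=
          setIntegral_le_integral hI (ae_of_all _ fun w =>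
            indicator_nonneg (fun u _ => inv_nonneg.2 (norm_nonneg u)) _)
      _ = _ := integral_sub_right_eq_self
          ((Metric.ball (0 : ℂ) ε).indicator fun u => ‖u‖⁻¹) z
  have hsmall : Tendsto (fun ε : ℝ => ∫ u, (Metric.ball (0 : ℂ) ε).indicator (fun u => ‖u‖⁻¹) u)
      (𝓝[>] 0) (𝓝 0) := by
    rw [show 𝓝 (0 : ℝ) = 𝓝 (∫ _ : ℂ, (0 : ℝ)) by simp]
    refine tendsto_integral_filter_of_dominated_convergence
      ((Metric.ball (0 : ℂ) 1).indicator fun u => ‖u‖⁻¹) ?_ ?_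
      (integrable_indicator_ball_norm_inv 1) ?_
    · exact Eventually.of_forall fun ε =>
        (integrable_indicator_ball_norm_inv ε).aestronglyMeasurable
    · filter_upwards [Ioo_mem_nhdsGT (show (0 : ℝ) < 1 by norm_num)] with ε hε
      refine ae_of_all _ fun u => ?_
      rw [Real.norm_of_nonneg (indicator_nonneg (fun u _ => inv_nonneg.2 (norm_nonneg u)) _)]
      exact indicator_le_indicator_of_subset (Metric.ball_subset_ball hε.2.le)
        (fun u => inv_nonneg.2 (norm_nonneg u)) u
    · refine ae_of_all _ fun u => ?_
      rcases eq_or_ne u 0 with rfl | hu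
      · simp [indicator]
      · refine tendsto_const_nhds.congr' ?_
        filter_upwards [Ioo_mem_nhdsGT (norm_pos_iff.2 hu)] with ε hε
        rw [indicator_of_notMem]
        simpa using hε.2.le
  refine continuous_of_uniform_approx_of_continuous fun V hV => ?_
  obtain ⟨δ, hδ, hδV⟩ := Metric.mem_uniformity_dist.1 hV
  obtain ⟨ε, hε, hεδ⟩ := (eventually_mem_nhdsWithin.and (hsmall.eventually_lt_const hδ)).exists
  exact ⟨_, hkcont ε hε, fun z => hδV ((herr ε hε z).trans_lt hεδ)⟩

lemma differentiableAt_cauchyTransform {K : Set ℂ} (hK : IsCompact K) {z : ℂ} (hz : z ∉ K) :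
    DifferentiableAt ℂ (cauchyTransform K) z := by
  have hKfin : IsFiniteMeasure (volume.restrict K) := ⟨by simpa using hK.measure_lt_top⟩
  obtain ⟨δ, hδ, hball⟩ := Metric.isOpen_iff.1 hK.isClosed.isOpen_compl z hz
  have hfar : ∀ w ∈ K, ∀ x ∈ Metric.ball z (δ / 2), δ / 2 ≤ ‖w - x‖ := by
    intro w hw x hx
    by_contra! hcon
    refine hball ?_ hw
    rw [Metric.mem_ball] at hx ⊢
    have := dist_triangle w x z
    rw [dist_eq_norm w x] at this
    linarith
  refine (hasDerivAt_integral_of_dominated_loc_of_deriv_le (μ := volume.restrict K)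
    (F := fun x w => (w - x)⁻¹) (F' := fun x w => ((w - x) ^ 2)⁻¹)
    (bound := fun _ => ((δ / 2) ^ 2)⁻¹) (Metric.ball_mem_nhds z (half_pos hδ)) ?_
    (integrableOn_sub_inv hK z) ?_ ?_ (integrable_const _) ?_).2.differentiableAt
  · exact Eventually.of_forall fun x => (integrableOn_sub_inv hK x).aestronglyMeasurable
  · exact ((measurable_id.sub_const z).pow_const 2).inv.aestronglyMeasurable
  · filter_upwards [ae_restrict_mem hK.measurableSet] with w hw x hx
    rw [norm_inv, norm_pow]
    have := hfar w hw x hx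
    gcongr
  · filter_upwards [ae_restrict_mem hK.measurableSet] with w hw x hx
    have hne : w - x ≠ 0 := norm_pos_iff.1 ((half_pos hδ).trans_le (hfar w hw x hx))
    convert! ((hasDerivAt_id x).const_sub w).inv hne using 1
    simp

lemma tendsto_cauchyTransform_cocompact {K : Set ℂ} (hK : IsCompact K) :
    Tendsto (cauchyTransform K) (cocompact ℂ) (𝓝 0) := by
  have hKfin : IsFiniteMeasure (volume.restrict K) := ⟨by simpa using hK.measure_lt_top⟩
  obtain ⟨R, hR⟩ := hK.isBounded.subset_closedBall 0
  have hnorm := tendsto_norm_cocompact_atTop (E := ℂ)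
  have hlim : Tendsto (fun z : ℂ => (‖z‖ - R)⁻¹ * volume.real K) (cocompact ℂ) (𝓝 0) := by
    have := ((tendsto_atTop_add_const_right _ (-R) hnorm).inv_tendsto_atTop).mul_const
      (volume.real K)
    simpa [sub_eq_add_neg] using this
  refine squeeze_zero_norm' ?_ hlim
  filter_upwards [hnorm.eventually_gt_atTop R] with z hz
  refine norm_setIntegral_le_of_norm_le_const hK.measure_lt_top fun w hw => ?_
  rw [norm_inv]
  have h1 : ‖w‖ ≤ R := by simpa using hR hw
  have h2 := norm_sub_norm_le z w
  rw [norm_sub_rev] at h2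
  exact inv_anti₀ (by linarith) (by linarith)

/-- To the left of `K` the real part of the Cauchy transform is positive. -/
lemma exists_notMem_cauchyTransform_ne_zero {K : Set ℂ} (hK : IsCompact K) (hpos : 0 < volume K) :
    ∃ a ∉ K, cauchyTransform K a ≠ 0 := by
  obtain ⟨R, hR⟩ := hK.isBounded.subset_closedBall 0
  set a : ℂ := ((-(R + 1) : ℝ) : ℂ)
  have hre : ∀ w ∈ K, 0 < (w - a).re := fun w hw => by
    have h1 : ‖w‖ ≤ R := by simpa using hR hw
    have h2 := (abs_le.1 ((Complex.abs_re_le_norm w).trans h1)).1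
    rw [Complex.sub_re, Complex.ofReal_re]
    linarith
  refine ⟨a, fun ha => by simpa using hre a ha, fun h0 => ?_⟩
  have hint := integrableOn_sub_inv hK a
  have hposre : ∀ w ∈ K, 0 < ((w - a)⁻¹).re := fun w hw => by
    rw [Complex.inv_re]
    refine div_pos (hre w hw) (Complex.normSq_pos.2 fun h => ?_)
    simpa [h] using hre w hw
  have h1 : ∫ w in K, ((w - a)⁻¹).re = 0 := by
    have := integral_re hint
    simp only [RCLike.re_eq_complex_re] at this
    rw [this]
    change (cauchyTransform K a).re = 0
    rw [h0, Complex.zero_re]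
  have h2 : 0 < ∫ w in K, ((w - a)⁻¹).re := by
    rw [setIntegral_pos_iff_support_of_nonneg_ae]
    · refine hpos.trans_le (measure_mono fun w hw => ⟨(hposre w hw).ne', hw⟩)
    · filter_upwards [ae_restrict_mem hK.measurableSet] with w hw
      exact (hposre w hw).le
    · exact hint.re
  exact h2.ne' h1

end CauchyTransform

/-! ### Rudin's algebra -/

section RudinAlgebra

/-- `IsRudin K g` says that `g` is continuous and bounded on the plane and holomorphic off `K`. -/
structure IsRudin (K : Set ℂ) (g : ℂ → ℂ) : Prop where
  continuous : Continuous g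
  bounded : ∃ M, ∀ z, ‖g z‖ ≤ M
  differentiableAt : ∀ z ∉ K, DifferentiableAt ℂ g z

lemma isRudin_const (K : Set ℂ) (c : ℂ) : IsRudin K fun _ => c :=
  ⟨continuous_const, ⟨‖c‖, fun _ => le_rfl⟩, fun _ _ => differentiableAt_const c⟩

lemma IsRudin.add {K : Set ℂ} {g h : ℂ → ℂ} (hg : IsRudin K g) (hh : IsRudin K h) :
    IsRudin K fun z => g z + h z := by
  obtain ⟨M, hM⟩ := hg.bounded
  obtain ⟨N, hN⟩ := hh.bounded
  exact ⟨hg.continuous.add hh.continuous,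
    ⟨M + N, fun z => (norm_add_le _ _).trans (add_le_add (hM z) (hN z))⟩,
    fun z hz => (hg.differentiableAt z hz).add (hh.differentiableAt z hz)⟩

lemma IsRudin.mul {K : Set ℂ} {g h : ℂ → ℂ} (hg : IsRudin K g) (hh : IsRudin K h) :
    IsRudin K fun z => g z * h z := by
  obtain ⟨M, hM⟩ := hg.bounded
  obtain ⟨N, hN⟩ := hh.bounded
  refine ⟨hg.continuous.mul hh.continuous, ⟨M * N, fun z => ?_⟩,
    fun z hz => (hg.differentiableAt z hz).mul (hh.differentiableAt z hz)⟩
  rw [norm_mul]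
  exact mul_le_mul (hM z) (hN z) (norm_nonneg _) ((norm_nonneg _).trans (hM z))

/-- The algebra is closed under division by `z - b` after subtracting the value at `b ∉ K`. -/
lemma IsRudin.dslope {K : Set ℂ} (hK : IsClosed K) {g : ℂ → ℂ} (hg : IsRudin K g) {b : ℂ}
    (hb : b ∉ K) : IsRudin K (dslope g b) := by
  have hcont : Continuous (_root_.dslope g b) := by
    have h1 : ContinuousOn (_root_.dslope g b) univ :=
      (continuousOn_dslope univ_mem).2 ⟨hg.continuous.continuousOn, hg.differentiableAt b hb⟩
    exact continuousOn_univ.1 h1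
  obtain ⟨M, hM⟩ := hg.bounded
  obtain ⟨C, hC⟩ := (isCompact_closedBall b 1).exists_bound_of_continuousOn hcont.continuousOn
  refine ⟨hcont, ⟨max C (M + M), fun z => ?_⟩, fun z hz => ?_⟩
  · by_cases hzb : z ∈ Metric.closedBall b 1
    · exact (hC z hzb).trans (le_max_left _ _)
    · refine le_trans ?_ (le_max_right _ _)
      rw [Metric.mem_closedBall, not_le, dist_eq_norm] at hzb
      have hne : z ≠ b := by rintro rfl; simp at hzb; linarith
      rw [dslope_of_ne _ hne, slope_def_field, norm_div]
      have h1 : ‖g z - g b‖ ≤ M + M := (norm_sub_le _ _).trans (add_le_add (hM z) (hM b))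
      exact (div_le_self (norm_nonneg _) hzb.le).trans h1
  · have h1 : DifferentiableOn ℂ g Kᶜ := fun z hz =>
      (hg.differentiableAt z hz).differentiableWithinAt
    have h2 := (Complex.differentiableOn_dslope (hK.isOpen_compl.mem_nhds hb)).2 h1
    exact h2.differentiableAt (hK.isOpen_compl.mem_nhds hz)

/-- The restrictions to `K` of the bounded continuous functions on the plane which are holomorphic
off `K`. -/
def rudinAlgebra (K : Set ℂ) : Subalgebra ℂ C(K, ℂ) where
  carrier := {φ | ∃ g, IsRudin K g ∧ ∀ x : K, φ x = g x}
  mul_mem' := by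
    rintro φ ψ ⟨g, hg, hφ⟩ ⟨h, hh, hψ⟩
    exact ⟨_, hg.mul hh, fun x => by simp [hφ, hψ]⟩
  add_mem' := by
    rintro φ ψ ⟨g, hg, hφ⟩ ⟨h, hh, hψ⟩
    exact ⟨_, hg.add hh, fun x => by simp [hφ, hψ]⟩
  algebraMap_mem' c := ⟨_, isRudin_const K c, fun x => by simp⟩

/-- The maximum principle on the complement of `K`, for functions vanishing at infinity. -/
lemma norm_le_of_tendsto_cocompact {K : Set ℂ} (hK : IsClosed K) {u : ℂ → ℂ} (hu : Continuous u)
    (hd : ∀ z ∉ K, DifferentiableAt ℂ u z) (hlim : Tendsto u (cocompact ℂ) (𝓝 0)) {C : ℝ}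
    (hC0 : 0 ≤ C) (hC : ∀ z ∈ K, ‖u z‖ ≤ C) (z : ℂ) : ‖u z‖ ≤ C := by
  refine le_of_forall_pos_le_add fun ε hε => ?_
  have hev : ∀ᶠ z in cocompact ℂ, ‖u z‖ < C + ε := by
    have := hlim.norm
    rw [norm_zero] at this
    exact this.eventually_lt_const (by linarith)
  obtain ⟨t, ht, htu⟩ := mem_cocompact.1 hev
  obtain ⟨R, htR⟩ := ht.isBounded.subset_closedBall 0
  have hR : ∀ {w}, w ∉ Metric.closedBall (0 : ℂ) R → ‖u w‖ < C + ε := fun hw =>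
    htu fun hwt => hw (htR hwt)
  by_cases hzU : z ∈ Metric.ball (0 : ℂ) (R + 1) \ K
  · have hopen : IsOpen (Metric.ball (0 : ℂ) (R + 1) \ K) := Metric.isOpen_ball.sdiff hK
    refine Complex.norm_le_of_forall_mem_frontier_norm_le (Metric.isBounded_ball.subset sdiff_subset)
      ⟨fun w hw => (hd w hw.2).differentiableWithinAt, hu.continuousOn⟩ (fun w hw => ?_)
      (subset_closure hzU)
    by_cases hwK : w ∈ K
    · linarith [hC w hwK]
    · have hw' : w ∉ Metric.ball (0 : ℂ) (R + 1) := fun h => by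
        rw [hopen.frontier_eq] at hw
        exact hw.2 ⟨h, hwK⟩
      refine (hR fun h => hw' ?_).le
      simp only [Metric.mem_closedBall, Metric.mem_ball] at h ⊢
      linarith
  · by_cases hzK : z ∈ K
    · linarith [hC z hzK]
    · have hz' : z ∉ Metric.ball (0 : ℂ) (R + 1) := fun h => hzU ⟨h, hzK⟩
      refine (hR fun h => hz' ?_).le
      simp only [Metric.mem_closedBall, Metric.mem_ball] at h ⊢
      linarith

/-- Maximum principle: `K` is a boundary for the algebra. The functions `g ^ n * h` vanish at
infinity, so the maximum principle bounds `‖g a‖ ^ n * ‖h a‖`; take `n`-th roots. -/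
lemma IsRudin.norm_le {K : Set ℂ} (hK : IsCompact K) {g h : ℂ → ℂ} (hg : IsRudin K g)
    (hh : IsRudin K h) (hlim : Tendsto h (cocompact ℂ) (𝓝 0)) {a : ℂ} (ha : h a ≠ 0) {C : ℝ}
    (hC0 : 0 ≤ C) (hC : ∀ z ∈ K, ‖g z‖ ≤ C) : ‖g a‖ ≤ C := by
  obtain ⟨N, hN⟩ := hh.bounded
  have hN0 : 0 ≤ N := (norm_nonneg _).trans (hN 0)
  obtain ⟨M, hM⟩ := hg.bounded
  have hbd : ∀ n : ℕ, ‖g a‖ ^ n * ‖h a‖ ≤ C ^ n * N := by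
    intro n
    rw [← norm_pow, ← norm_mul]
    refine norm_le_of_tendsto_cocompact (u := fun z => g z ^ n * h z) hK.isClosed
      ((hg.continuous.pow n).mul hh.continuous)
      (fun z hz => ((hg.differentiableAt z hz).pow n).mul (hh.differentiableAt z hz)) ?_
      (by positivity) (fun z hz => ?_) a
    · refine squeeze_zero_norm (a := fun z => M ^ n * ‖h z‖) (fun z => ?_) ?_
      · rw [norm_mul, norm_pow]
        gcongr
        exact hM z
      · simpa using hlim.norm.const_mul (M ^ n)
    · rw [norm_mul, norm_pow]
      gcongr
      · exact hC z hz
      · exact hN z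
  by_contra! hcon
  have hga : 0 < ‖g a‖ := hC0.trans_lt hcon
  have h1 : Tendsto (fun n : ℕ => (C / ‖g a‖) ^ n * N) atTop (𝓝 0) := by
    have := (tendsto_pow_atTop_nhds_zero_of_lt_one (div_nonneg hC0 hga.le)
      ((div_lt_one hga).2 hcon)).mul_const N
    simpa using this
  have h2 : ‖h a‖ ≤ 0 := by
    refine ge_of_tendsto' h1 fun n => ?_
    have := hbd n
    rw [div_pow, div_mul_eq_mul_div, le_div_iff₀ (by positivity)]
    linarith
  exact ha (norm_le_zero_iff.1 h2)

/-- If `K` has positive area, the evaluation at a point off `K` is a bounded character of the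
algebra different from all evaluations at points of `K`; so the algebra is not dense. -/
lemma not_hasCSWP_of_volume_pos {K : Set ℂ} (hK : IsCompact K)
    (hpos : 0 < MeasureTheory.volume K) : ¬ HasCSWP K := by
  have hKc : CompactSpace K := isCompact_iff_compactSpace.1 hK
  set f := cauchyTransform K
  have hflim : Tendsto f (cocompact ℂ) (𝓝 0) := tendsto_cauchyTransform_cocompact hK
  have hf : IsRudin K f := by
    refine ⟨continuous_cauchyTransform hK, ?_, fun z => differentiableAt_cauchyTransform hK⟩
    have hev : ∀ᶠ z in cocompact ℂ, ‖f z‖ < 1 := by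
      have := hflim.norm
      rw [norm_zero] at this
      exact this.eventually_lt_const one_pos
    obtain ⟨t, ht, htf⟩ := mem_cocompact.1 hev
    obtain ⟨C, hC⟩ := ht.exists_bound_of_continuousOn (continuous_cauchyTransform hK).continuousOn
    refine ⟨max C 1, fun z => ?_⟩
    by_cases hz : z ∈ t
    · exact (hC z hz).trans (le_max_left _ _)
    · have h1 : ‖f z‖ < 1 := htf hz
      exact h1.le.trans (le_max_right _ _)
  obtain ⟨a, haK, ha⟩ := exists_notMem_cauchyTransform_ne_zero hK hpos
  have hother : ∀ c, ∃ b ∉ K, f b ≠ c := by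
    intro c
    by_cases hc : f a = c
    · have h1 : ∀ᶠ z in cocompact ℂ, z ∉ K := hK.compl_mem_cocompact
      have h2 : ∀ᶠ z in cocompact ℂ, f z ≠ c := hflim.eventually_ne (by rw [← hc]; exact ha.symm)
      exact (h1.and h2).exists
    · exact ⟨a, haK, hc⟩
  -- Members of the algebra separate each point of `K` from every other point of `K` and from `a`.
  have hsep : ∀ p ∈ K, ∀ q, q ∈ K ∨ q = a → p ≠ q → ∃ g, IsRudin K g ∧ g p ≠ g q := by
    intro p hp q hq hpq
    by_cases hpq' : f p = f q
    · obtain ⟨b, hbK, hb⟩ := hother (f q)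
      have hpb : p ≠ b := fun h => hbK (h ▸ hp)
      have hqb : q ≠ b := fun h => hb (h ▸ rfl)
      refine ⟨dslope f b, hf.dslope hK.isClosed hbK, fun h => ?_⟩
      rw [dslope_of_ne _ hpb, dslope_of_ne _ hqb, slope_def_field, slope_def_field, hpq',
        div_eq_div_iff (sub_ne_zero.2 hpb) (sub_ne_zero.2 hqb)] at h
      have h3 := mul_left_cancel₀ (sub_ne_zero.2 hb.symm) h
      exact hpq (by linear_combination -h3)
    · exact ⟨f, hf, hpq'⟩
  intro hCSWP
  have hdense := hCSWP (rudinAlgebra K) (by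
    intro p q hpq
    obtain ⟨g, hg, hne⟩ := hsep p p.2 q (Or.inl q.2) (fun h => hpq (Subtype.ext h))
    exact ⟨_, ⟨⟨fun x => g x, hg.continuous.comp continuous_subtype_val⟩, ⟨g, hg, fun x => rfl⟩,
      rfl⟩, hne⟩)
  -- The closure of the kernel of the evaluation at `a` is an ideal of `C(K, ℂ)` without common
  -- zeros.
  let N : Set C(K, ℂ) := {φ | ∃ g, IsRudin K g ∧ (∀ x : K, φ x = g x) ∧ g a = 0}
  let I : Ideal C(K, ℂ) :=
    { carrier := closure N
      add_mem' := fun {φ ψ} hφ hψ => map_mem_closure₂ continuous_add hφ hψ (by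
        rintro _ ⟨g, hg, hφ, hga⟩ _ ⟨h, hh, hψ, hha⟩
        exact ⟨_, hg.add hh, fun x => by simp [hφ, hψ], by simp [hga, hha]⟩)
      zero_mem' := subset_closure ⟨_, isRudin_const K 0, fun x => rfl, rfl⟩
      smul_mem' := fun c φ hφ => map_mem_closure₂ continuous_mul (hdense c) hφ (by
        rintro _ ⟨g, hg, hφ⟩ _ ⟨h, hh, hψ, hha⟩
        exact ⟨_, hg.mul hh, fun x => by simp [hφ, hψ], by simp [hha]⟩) }
  have hI : IsClosed (I : Set C(K, ℂ)) := isClosed_closure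
  have hIset : ContinuousMap.setOfIdeal I = univ := by
    refine eq_univ_of_forall fun p => ContinuousMap.mem_setOfIdeal.2 ?_
    obtain ⟨g, hg, hne⟩ := hsep p p.2 a (Or.inr rfl) (fun h => haK (h ▸ p.2))
    have hg' := hg.add (isRudin_const K (-g a))
    exact ⟨⟨fun x => g x + -g a, hg'.continuous.comp continuous_subtype_val⟩,
      subset_closure ⟨_, hg', fun x => rfl, add_neg_cancel _⟩,
      fun h => hne (by simpa [add_neg_eq_zero] using h)⟩
  have hone : (1 : C(K, ℂ)) ∈ closure N := by
    have h1 := ContinuousMap.idealOfSet_ofIdeal_isClosed hI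
    have h2 : (1 : C(K, ℂ)) ∈ I := by
      rw [← h1, hIset, ContinuousMap.mem_idealOfSet]
      simp
    exact h2
  obtain ⟨φ, ⟨g, hg, hφ, hga⟩, hdist⟩ := Metric.mem_closure_iff.1 hone (1 / 2) (by norm_num)
  have hle : ‖g a + -1‖ ≤ 1 / 2 := by
    refine IsRudin.norm_le hK (hg.add (isRudin_const K (-1))) hf hflim ha (by norm_num)
      fun z hz => ?_
    have := (ContinuousMap.dist_apply_le_dist (f := 1) (g := φ) ⟨z, hz⟩).trans_lt hdist
    rw [dist_comm, dist_eq_norm, hφ] at this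
    simpa [sub_eq_add_neg] using this.le
  rw [hga] at hle
  norm_num at hle

end RudinAlgebra

/-! ### Transfer to spaces containing a Cantor set -/

section Transfer

/-- The CSWP passes to closed subspaces: pull an algebra on the subspace back along restriction,
which is onto by Tietze's theorem. -/
lemma HasCSWP.of_isClosedEmbedding {X Y : Type*} [TopologicalSpace X] [TopologicalSpace Y]
    [NormalSpace X] [T1Space X] {e : Y → X} (he : IsClosedEmbedding e) (hX : HasCSWP X) :
    HasCSWP Y := by
  intro A hA
  set ρ := ContinuousMap.compRightAlgHom ℂ ℂ (⟨e, he.continuous⟩ : C(Y, X))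
  have hρ : ∀ g y, ρ g y = g (e y) := fun g y => rfl
  have hsurj : Function.Surjective ρ := fun g => ContinuousMap.exists_extension he g
  have hρc : Continuous ρ := ContinuousMap.continuous_precomp _
  -- Points outside the range of `e` are separated from others by functions vanishing on it.
  have hout : ∀ x ∉ range e, ∀ y, x ≠ y → ∃ f ∈ A.comap ρ, f x ≠ f y := by
    intro x hx y hxy
    obtain ⟨f, hf0, hf1, -⟩ := exists_continuous_zero_one_of_isClosed
      (he.isClosed_range.union (isClosed_singleton (x := y))) (isClosed_singleton (x := x))
      (disjoint_singleton_right.2 (by simp [hx, hxy]))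
    refine ⟨⟨fun z => (f z : ℂ), by fun_prop⟩, ?_, ?_⟩
    · have : ρ ⟨fun z => (f z : ℂ), by fun_prop⟩ = 0 := by
        ext w
        rw [hρ]
        have := hf0 (Or.inl ⟨w, rfl⟩ : e w ∈ range e ∪ {y})
        simp_all
      rw [Subalgebra.mem_comap, this]
      exact A.zero_mem
    · have h0 := hf0 (Or.inr rfl : y ∈ range e ∪ {y})
      have h1 := hf1 rfl
      simp_all
  have hsep : (A.comap ρ).SeparatesPoints := by
    intro x y hxy
    suffices h : ∃ f ∈ A.comap ρ, f x ≠ f y by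
      obtain ⟨f, hf, hne⟩ := h
      exact ⟨_, ⟨f, hf, rfl⟩, hne⟩
    by_cases hx : x ∈ range e
    · by_cases hy : y ∈ range e
      · obtain ⟨x, rfl⟩ := hx
        obtain ⟨y, rfl⟩ := hy
        obtain ⟨_, ⟨f, hf, rfl⟩, hne⟩ := hA (fun h => hxy (congrArg e h) : x ≠ y)
        obtain ⟨g, rfl⟩ := hsurj f
        exact ⟨g, hf, hne⟩
      · obtain ⟨f, hf, hne⟩ := hout y hy x hxy.symm
        exact ⟨f, hf, hne.symm⟩
    · exact hout x hx y hxy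
  refine (hsurj.denseRange.dense_image hρc (hX _ hsep)).mono ?_
  rintro _ ⟨f, hf, rfl⟩
  exact hf

/-- Comparing the coordinates with the rationals gives countably many clopen sets separating
points. -/
lemma exists_isEmbedding_cantorSet {K : Set ℂ} (hK : IsCompact K)
    (hirr : ∀ z ∈ K, Irrational z.re ∧ Irrational z.im) :
    ∃ e : K → cantorSet, IsEmbedding e := by
  have hKc : CompactSpace K := isCompact_iff_compactSpace.1 hK
  -- Comparison of an irrational-valued continuous function with a rational is locally constant.
  have hclopen : ∀ φ : K → ℝ, Continuous φ → (∀ z, Irrational (φ z)) → ∀ q : ℚ,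
      Continuous ({z | (q : ℝ) < φ z}.boolIndicator) := by
    intro φ hφ hφi q
    rw [continuous_boolIndicator_iff_isClopen]
    refine ⟨?_, isOpen_lt continuous_const hφ⟩
    have : {z | (q : ℝ) < φ z} = {z | (q : ℝ) ≤ φ z} := by
      ext z
      exact ⟨fun h => le_of_lt (b := φ z) h,
        fun h => lt_of_le_of_ne (b := φ z) h fun h' => hφi z ⟨q, h'⟩⟩
    rw [this]
    exact isClosed_le continuous_const hφ
  let Φ : K → (ℚ ⊕ ℚ → Bool) := fun z => Sum.elim
    (fun q => {z : K | (q : ℝ) < (z : ℂ).re}.boolIndicator z)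
    (fun q => {z : K | (q : ℝ) < (z : ℂ).im}.boolIndicator z)
  have hΦc : Continuous Φ := by
    refine continuous_pi fun i => ?_
    rcases i with q | q
    · exact hclopen (fun z => (z : ℂ).re) (by fun_prop) (fun z => (hirr z z.2).1) q
    · exact hclopen (fun z => (z : ℂ).im) (by fun_prop) (fun z => (hirr z z.2).2) q
  have hreal : ∀ s t : ℝ, (∀ q : ℚ, (q : ℝ) < s ↔ (q : ℝ) < t) → s = t := by
    intro s t h
    by_contra hne
    rcases lt_or_gt_of_ne hne with hlt | hlt
    · obtain ⟨q, h1, h2⟩ := exists_rat_btwn hlt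
      exact h1.not_gt ((h q).2 h2)
    · obtain ⟨q, h1, h2⟩ := exists_rat_btwn hlt
      exact h1.not_gt ((h q).1 h2)
  have hΦi : Function.Injective Φ := by
    intro z w h
    refine Subtype.ext (Complex.ext (hreal _ _ fun q => ?_) (hreal _ _ fun q => ?_))
    · have := congrFun h (Sum.inl q)
      simp only [Φ, Sum.elim_inl] at this
      have h1 := mem_iff_boolIndicator {z : K | (q : ℝ) < (z : ℂ).re} z
      rw [this, ← mem_iff_boolIndicator] at h1
      exact h1
    · have := congrFun h (Sum.inr q)
      simp only [Φ, Sum.elim_inr] at this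
      have h1 := mem_iff_boolIndicator {z : K | (q : ℝ) < (z : ℂ).im} z
      rw [this, ← mem_iff_boolIndicator] at h1
      exact h1
  let E : (ℚ ⊕ ℚ → Bool) ≃ₜ (ℕ → Bool) :=
    Homeomorph.piCongrLeft (Y := fun _ => Bool) (Denumerable.eqv (ℚ ⊕ ℚ))
  exact ⟨_, cantorSetHomeomorphNatToBool.symm.isEmbedding.comp
    (E.isEmbedding.comp (hΦc.isClosedEmbedding hΦi).isEmbedding)⟩

theorem not_containsCantorSet_of_hasCSWP {X : Type*} [TopologicalSpace X] [CompactSpace X]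
    [T2Space X] (hX : HasCSWP X) : ¬ ContainsCantorSet X := by
  rintro ⟨j, hj⟩
  obtain ⟨K, hK, hpos, hirr⟩ := exists_isCompact_irrational_re_im
  have hKc : CompactSpace K := isCompact_iff_compactSpace.1 hK
  obtain ⟨e, he⟩ := exists_isEmbedding_cantorSet hK hirr
  have hje := hj.comp he
  exact not_hasCSWP_of_volume_pos hK hpos
    (hX.of_isClosedEmbedding (hje.continuous.isClosedEmbedding hje.injective))

end Transfer

theorem lemma4p15 (X : Type*) [LinearOrder X] [TopologicalSpace X] [OrderTopology X]
    [CompactSpace X] [TopologicalSpace.SeparableSpace X] :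
    HasCSWP X ↔ ¬ ContainsCantorSet X :=
  ⟨not_containsCantorSet_of_hasCSWP, hasCSWP_of_not_containsCantorSet⟩
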